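/- For a finite multiset $Y$ of $n$ points of $\mathbb{R}^d$ (counted with multiplicity), a nonempty finite set $C\subset\mathbb{R}^d$ and weights $v=(v_1,\dots,v_n)$, let $$\mathrm{cost}_v(Y,C)=\sum_{i=1}^n v_i\, d(y_i,C),\qquad d(y,C)=\min_{c\in C}\|y-c\|_2,$$ where the points of $Y$ are numbered so that $d(y_1,C)\ge\dots\ge d(y_n,C)$. Let $X\subset\mathbb{R}^d$ be a set of $n$ points. A simultaneous $\varepsilon$-coreset of $X$ for Ordered $k$-Median is a multiset $D$ of $n$ points of $\mathbb{R}^d$ (counted with multiplicity) such that $$(1-\varepsilon)\,\mathrm{cost}_v(X,C)\le \mathrm{cost}_v(D,C)\le(1+\varepsilon)\,\mathrm{cost}_v(X,C)$$ for all $C\subset\mathbb{R}^d$ with $|C|=k$ and all $v_1\ge\dots\ge v_n\ge 0$ at once; its size is the number of distinct points in $D$. Theorem. There is an absolute constant $A$ such that for every $k\ge 1$, $\varepsilon\in(0,1)$ and every set $X\subset\mathbb{R}^d$ of $n\ge 2$ points there is a simultaneous $\varepsilon$-coreset of $X$ for Ordered $k$-Median of size at most $$A^d\cdot\frac{k^2\log^2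 n}{\varepsilon^d}.$$ Moreover, such a coreset can be computed in polynomial time: a single real-RAM program (exact unit-cost $+,-,\times,/$ and comparison on real numbers; unit-cost addition, truncated subtraction and comparison on natural numbers, which serve as addresses), given $n$, $d$, $k$, $\varepsilon$ and the points of $X$ in any order, outputs the distinct points of such a coreset with their multiplicities after a number of steps that is bounded by a fixed polynomial in $nd$. -/

import Mathlib

noncomputable section

/-! ### The Ordered k-Median objective and simultaneous coresets -/

namespace OrderedMedian

/-- The distances `d(x, C)` of the points of the multiset `X` to the center set `C`,
listed in non-increasing order. -/
def sortedDist {d : ℕ} (X : Multiset (EuclideanSpace ℝ (Fin d)))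
    (C : Finset (EuclideanSpace ℝ (Fin d))) : List ℝ :=
  (X.map fun x => Metric.infDist x (C : Set (EuclideanSpace ℝ (Fin d)))).sort (· ≥ ·)

/-- `cost_v(X, C) = ∑ v_i d(x_i, C)` where `d(x_1, C) ≥ d(x_2, C) ≥ ⋯`. It is only used for
multisets `X` with exactly `n` points (counted with multiplicity). -/
def cost {d n : ℕ} (v : Fin n → ℝ) (X : Multiset (EuclideanSpace ℝ (Fin d)))
    (C : Finset (EuclideanSpace ℝ (Fin d))) : ℝ :=
  ∑ i : Fin n, v i * (sortedDist X C).getD i 0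

/-- `D` is a simultaneous `ε`-coreset of `X` for Ordered `k`-Median: `D` is a multiset with the
same total multiplicity as `X`, and the cost is preserved up to a factor `1 ± ε` for every set of
`k` centers and every non-increasing vector of non-negative weights. -/
def IsSimultaneousCoreset {d : ℕ} (k : ℕ) (ε : ℝ)
    (X D : Multiset (EuclideanSpace ℝ (Fin d))) : Prop :=
  D.card = X.card ∧
    ∀ C : Finset (EuclideanSpace ℝ (Fin d)), C.card = k →
      ∀ v : Fin X.card → ℝ, Antitone v → (∀ i, 0 ≤ v i) →
        (1 - ε) * cost v X C ≤ cost v D C ∧ cost v D C ≤ (1 + ε) * cost v X C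

open Classical in
/-- The size of a coreset: the number of distinct points in it. -/
def size {d : ℕ} (D : Multiset (EuclideanSpace ℝ (Fin d))) : ℕ := D.toFinset.card

end OrderedMedian

/-! ### A real RAM with step count

Real numbers are handled by `+, -, *, /` and comparison only (no rounding, no roots); natural
numbers, which also serve as addresses, by addition, truncated subtraction and comparison only. -/

namespace RealRAM

/-- Registers and memory cells, for natural numbers and for real numbers. -/
structure State where
  natReg : ℕ → ℕ
  natMem : ℕ → ℕ
  realReg : ℕ → ℝ
  realMem : ℕ → ℝ

/-- Elementary instructions; all parameters except constants are numbers of registers.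
The first parameter is the target (for the `store` instructions: the register with the address). -/
inductive Instr where
  | skip
  | natConst (a c : ℕ)
  | natAdd (a b c : ℕ)
  | natSub (a b c : ℕ)
  | natLoad (a b : ℕ)
  | natStore (a b : ℕ)
  | realConst (a : ℕ) (z : ℤ)
  | realAdd (a b c : ℕ)
  | realSub (a b c : ℕ)
  | realMul (a b c : ℕ)
  | realDiv (a b c : ℕ)
  | realLoad (a b : ℕ)
  | realStore (a b : ℕ)

/-- The effect of an elementary instruction. -/
def Instr.run : Instr → State → State
  | .skip, s => s
  | .natConst a c, s => { s with natReg := Function.update s.natReg a c }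
  | .natAdd a b c, s =>
      { s with natReg := Function.update s.natReg a (s.natReg b + s.natReg c) }
  | .natSub a b c, s =>
      { s with natReg := Function.update s.natReg a (s.natReg b - s.natReg c) }
  | .natLoad a b, s =>
      { s with natReg := Function.update s.natReg a (s.natMem (s.natReg b)) }
  | .natStore a b, s =>
      { s with natMem := Function.update s.natMem (s.natReg a) (s.natReg b) }
  | .realConst a z, s => { s with realReg := Function.update s.realReg a (z : ℝ) }
  | .realAdd a b c, s =>
      { s with realReg := Function.update s.realReg a (s.realReg b + s.realReg c) }
  | .realSub a b c, s =>
      { s with realReg := Function.update s.realReg a (s.realReg b - s.realReg c) }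
  | .realMul a b c, s =>
      { s with realReg := Function.update s.realReg a (s.realReg b * s.realReg c) }
  | .realDiv a b c, s =>
      { s with realReg := Function.update s.realReg a (s.realReg b / s.realReg c) }
  | .realLoad a b, s =>
      { s with realReg := Function.update s.realReg a (s.realMem (s.natReg b)) }
  | .realStore a b, s =>
      { s with realMem := Function.update s.realMem (s.natReg a) (s.realReg b) }

/-- Tests: comparison of two registers. -/
inductive Test where
  | natLe (a b : ℕ)
  | realLe (a b : ℕ)

def Test.Holds : Test → State → Prop
  | .natLe a b, s => s.natReg a ≤ s.natReg b
  | .realLe a b, s => s.realReg a ≤ s.realReg b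

/-- Programs: finite structured programs. -/
inductive Prog where
  | instr (i : Instr)
  | seq (p q : Prog)
  | ite (c : Test) (p q : Prog)
  | while (c : Test) (p : Prog)

/-- `Exec p s t s'`: started in state `s`, the program `p` halts in state `s'` after exactly `t`
steps, where every elementary instruction and every evaluation of a test is one step. -/
inductive Exec : Prog → State → ℕ → State → Prop where
  | instr (i : Instr) (s : State) : Exec (.instr i) s 1 (i.run s)
  | seq {p q : Prog} {s s' s'' : State} {t t' : ℕ} :
      Exec p s t s' → Exec q s' t' s'' → Exec (.seq p q) s (t + t') s''
  | iteTrue {c : Test} {p q : Prog} {s s' : State} {t : ℕ} :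
      c.Holds s → Exec p s t s' → Exec (.ite c p q) s (t + 1) s'
  | iteFalse {c : Test} {p q : Prog} {s s' : State} {t : ℕ} :
      ¬ c.Holds s → Exec q s t s' → Exec (.ite c p q) s (t + 1) s'
  | whileTrue {c : Test} {p : Prog} {s s' s'' : State} {t t' : ℕ} :
      c.Holds s → Exec p s t s' → Exec (.while c p) s' t' s'' →
        Exec (.while c p) s (t + t' + 1) s''
  | whileFalse {c : Test} {p : Prog} {s : State} :
      ¬ c.Holds s → Exec (.while c p) s 1 s

/-- The initial state for the instance `(n, d, k, ε, x_0, …, x_{n-1})`: the first three natural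
registers hold `n, d, k`, the first real register holds `ε`, and the `j`-th coordinate of `x_i` is
in real memory cell `i * d + j`; everything else is `0`. -/
def inputState {n d : ℕ} (k : ℕ) (ε : ℝ) (x : Fin n → EuclideanSpace ℝ (Fin d)) : State where
  natReg a := if a = 0 then n else if a = 1 then d else if a = 2 then k else 0
  natMem _ := 0
  realReg a := if a = 0 then ε else 0
  realMem a :=
    if h : a < n * d then
      x (finProdFinEquiv.symm ⟨a, h⟩).1 (finProdFinEquiv.symm ⟨a, h⟩).2
    else 0

open Classical in
/-- The state `s` represents the multiset `D`: for some enumeration `y_0, …, y_{m-1}` of its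
distinct points, `m` is in natural register `0`, the multiplicity of `y_i` is in natural memory
cell `i`, and the `j`-th coordinate of `y_i` is in real memory cell `i * d + j`. -/
def Represents {d : ℕ} (s : State) (D : Multiset (EuclideanSpace ℝ (Fin d))) : Prop :=
  s.natReg 0 = OrderedMedian.size D ∧
    ∃ y : Fin (OrderedMedian.size D) → EuclideanSpace ℝ (Fin d),
      Function.Injective y ∧ ∀ i, y i ∈ D ∧ s.natMem i = D.count (y i) ∧
        ∀ j : Fin d, s.realMem (i * d + j) = y i j

end RealRAM

end

/-!
Idea: a simultaneous coreset only has to move every point by a small amount relative to *every*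
center set. Starting with `U = X`, repeatedly remove from `U` a smallest ball around one of its
points that contains at least a `1 / (2 k)` fraction of `U`. Every round shrinks `U` by the factor
`1 - 1 / (2 k)`, so that there are at most `2 k log n + 1` rounds.

If at least half of the `u` points of `U` are within `r` of some `k` centers, then by the pigeonhole
principle the points near one of the centers form a heavy ball of radius at most `2 r`. Hence the
radius at which a point is removed is at most twice the distance of rank `⌊u / 2⌋` to the centers,
for any set of `k` centers. As the weights are non-increasing, halving the rank costs at most a
factor `2`, and moving every point by `ε / 4` times its radius changes the cost by at most the
fraction `ε`.

Finally, every point is moved to its representative in a greedy net at this scale. By volume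
packing, the net has `O(1 / ε) ^ d` points per round. Since the machine has no square roots, all
distances are handled through their squares.
-/

noncomputable section

namespace OrderedMedian

section Packing

open MeasureTheory Metric Module

variable {ι E : Type*} [NormedAddCommGroup E] [NormedSpace ℝ E] [FiniteDimensional ℝ E]

theorem card_le_of_pairwise_le_dist (S : Finset ι) (y : ι → E) (c : E) {g s : ℝ} (hg : 0 ≤ g)
    (hs : 0 < s) (hball : ∀ i ∈ S, dist (y i) c ≤ g)
    (hsep : (S : Set ι).Pairwise fun i j => s ≤ dist (y i) (y j)) :
    (S.card : ℝ) ≤ (1 + 2 * g / s) ^ finrank ℝ E := by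
  borelize E
  let μ : Measure E := Measure.addHaar
  have hδ : 0 < s / 2 := by positivity
  have hρ : 0 < g + s / 2 := by positivity
  have hdisj : (S : Set ι).PairwiseDisjoint fun i => ball (y i) (s / 2) := fun i hi j hj hij =>
    ball_disjoint_ball (by linarith [hsep hi hj hij])
  have hsub : (⋃ i ∈ S, ball (y i) (s / 2)) ⊆ ball c (g + s / 2) :=
    Set.iUnion₂_subset fun i hi => ball_subset_ball' (by linarith [hball i hi])
  have hvol : (S.card : ENNReal) * ENNReal.ofReal ((s / 2) ^ finrank ℝ E) * μ (ball 0 1) ≤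
      ENNReal.ofReal ((g + s / 2) ^ finrank ℝ E) * μ (ball 0 1) :=
    calc
      _ = μ (⋃ i ∈ S, ball (y i) (s / 2)) := by
        rw [measure_biUnion_finset hdisj fun _ _ => measurableSet_ball]
        simp only [μ.addHaar_ball_of_pos _ hδ, Finset.sum_const, nsmul_eq_mul, mul_assoc]
      _ ≤ μ (ball c (g + s / 2)) := measure_mono hsub
      _ = _ := μ.addHaar_ball_of_pos _ hρ
  have hreal := ENNReal.toReal_le_of_le_ofReal (pow_nonneg hρ.le _) <|
    (ENNReal.mul_le_mul_iff_left (measure_ball_pos _ _ zero_lt_one).ne' measure_ball_lt_top.ne).1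
      hvol
  rw [ENNReal.toReal_mul, ENNReal.toReal_natCast, ENNReal.toReal_ofReal (by positivity)] at hreal
  rwa [show 1 + 2 * g / s = (g + s / 2) / (s / 2) by field_simp; ring, div_pow,
    le_div_iff₀ (by positivity)]

theorem card_le_of_pairwise_mul_lt_dist (S : Finset ι) (y : ι → E) (c : E) {g δ : ℝ} (hg : 0 ≤ g)
    (hδ : 0 < δ) (hball : ∀ i ∈ S, dist (y i) c ≤ g)
    (hsep : (S : Set ι).Pairwise fun i j => δ * g < dist (y i) (y j)) :
    (S.card : ℝ) ≤ (1 + 2 / δ) ^ finrank ℝ E := by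
  rcases hg.eq_or_lt with rfl | hg
  · have hone : S.card ≤ 1 := by
      refine Finset.card_le_one.2 fun i hi j hj => by_contra fun hij => ?_
      have := hsep hi hj hij
      have := dist_triangle_right (y i) (y j) c
      linarith [hball i hi, hball j hj]
    calc (S.card : ℝ) ≤ 1 := by exact_mod_cast hone
      _ ≤ _ := one_le_pow₀ (le_add_of_nonneg_right (by positivity))
  · have h := card_le_of_pairwise_le_dist S y c hg.le (mul_pos hδ hg) hball
      fun i hi j hj hij => (hsep hi hj hij).le
    rwa [mul_div_mul_right _ _ hg.ne'] at h

end Packing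

section Rearrangement

variable {n : ℕ} {v : Fin n → ℝ}

theorem sum_mul_half_le (hv : Antitone v) (hv0 : ∀ i, 0 ≤ v i) {a : ℕ → ℝ} (ha : ∀ i, 0 ≤ a i) :
    ∑ i : Fin n, v i * a (i / 2) ≤ 2 * ∑ i : Fin n, v i * a i := by
  let half : Fin n → Fin n := fun i => ⟨i / 2, (Nat.div_le_self _ _).trans_lt i.2⟩
  have hfiber : ∀ j, (Finset.univ.filter fun i => half i = j).card ≤ 2 := fun j => by
    rw [← Finset.card_map Fin.valEmbedding]
    refine (Finset.card_le_card (t := {2 * (j : ℕ), 2 * (j : ℕ) + 1}) fun i hi => ?_).trans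
      Finset.card_le_two
    simp only [half, Finset.mem_map, Finset.mem_filter, Finset.mem_univ, true_and, Fin.ext_iff,
      Fin.valEmbedding_apply] at hi
    obtain ⟨i, hi, rfl⟩ := hi
    simp only [Finset.mem_insert, Finset.mem_singleton]
    omega
  calc ∑ i : Fin n, v i * a (i / 2) ≤ ∑ i, v (half i) * a (half i) :=
        Finset.sum_le_sum fun i _ =>
          mul_le_mul_of_nonneg_right (hv (Nat.div_le_self (i : ℕ) 2)) (ha _)
    _ = ∑ j, (Finset.univ.filter fun i => half i = j).card • (v j * a j) :=
        (Finset.sum_comp (fun j => v j * a j) half).trans <|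
          Finset.sum_subset (Finset.subset_univ _) fun j _ hj => by
            rw [Finset.card_eq_zero.2 (Finset.filter_eq_empty_iff.2 fun i hi hij =>
              hj (Finset.mem_image.2 ⟨i, hi, hij⟩)), zero_smul]
    _ ≤ ∑ j, 2 • (v j * a j) := Finset.sum_le_sum fun j _ =>
        nsmul_le_nsmul_left (mul_nonneg (hv0 j) (ha j)) (hfiber j)
    _ = _ := by simp only [nsmul_eq_mul, Nat.cast_ofNat, Finset.mul_sum]

theorem sum_mul_comp_le (hv : Antitone v) (hv0 : ∀ i, 0 ≤ v i) {u : Fin n → ℕ}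
    (hu : ∀ i, (Finset.univ.filter fun j => u j ≤ u i).card ≤ u i) {f : ℕ → ℝ} (hf : Antitone f)
    (σ : Equiv.Perm (Fin n)) :
    ∑ i, v i * f (u (σ i)) ≤ ∑ i : Fin n, v i * f i := by
  let τ := Tuple.sort u
  have hτ : Monotone (u ∘ τ) := Tuple.monotone_sort u
  have hle : ∀ i : Fin n, (i : ℕ) ≤ u (τ i) := fun i =>
    calc (i : ℕ) ≤ (Finset.Iic i).card := by rw [Fin.card_Iic]; exact Nat.le_succ _
      _ = ((Finset.Iic i).map τ.toEmbedding).card := (Finset.card_map _).symm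
      _ ≤ (Finset.univ.filter fun j => u j ≤ u (τ i)).card :=
          Finset.card_le_card <| Finset.map_subset_iff_subset_preimage.2 fun j hj => by
            simpa using hτ (Finset.mem_Iic.1 hj)
      _ ≤ u (τ i) := hu _
  calc ∑ i, v i * f (u (σ i)) ≤ ∑ i, v i * f (u (τ i)) := by
        simpa using (hv.monovary (hf.comp_monotone hτ)).sum_mul_comp_perm_le_sum_mul
          (σ := σ.trans τ.symm)
    _ ≤ _ := Finset.sum_le_sum fun i _ => mul_le_mul_of_nonneg_left (hf (hle i)) (hv0 i)

end Rearrangement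

section Cost

variable {d n : ℕ}

theorem sortedDist_getD_nonneg (X : Multiset (EuclideanSpace ℝ (Fin d)))
    (C : Finset (EuclideanSpace ℝ (Fin d))) (w : ℕ) : 0 ≤ (sortedDist X C).getD w 0 := by
  rcases lt_or_ge w (sortedDist X C).length with hw | hw
  · rw [List.getD_eq_getElem _ _ hw]
    obtain ⟨p, -, hp⟩ := Multiset.mem_map.1 ((Multiset.mem_sort _).1 (List.getElem_mem hw))
    exact hp ▸ Metric.infDist_nonneg
  · rw [List.getD_eq_default _ _ hw]

theorem antitone_sortedDist_getD (X : Multiset (EuclideanSpace ℝ (Fin d)))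
    (C : Finset (EuclideanSpace ℝ (Fin d))) : Antitone fun w => (sortedDist X C).getD w 0 := by
  intro a b hab
  rcases hab.eq_or_lt with rfl | hab
  · rfl
  rcases lt_or_ge b (sortedDist X C).length with hb | hb
  · simp only [List.getD_eq_getElem _ _ hb, List.getD_eq_getElem _ _ (hab.trans hb)]
    exact List.pairwise_iff_getElem.1 (Multiset.pairwise_sort _ (· ≥ ·)) a b _ _ hab
  · simp only [List.getD_eq_default _ _ hb]
    exact sortedDist_getD_nonneg X C a

theorem exists_perm_sortedDist (y : Fin n → EuclideanSpace ℝ (Fin d))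
    (C : Finset (EuclideanSpace ℝ (Fin d))) :
    ∃ σ : Equiv.Perm (Fin n),
      Antitone (fun i => Metric.infDist (y (σ i)) (C : Set (EuclideanSpace ℝ (Fin d)))) ∧
      ∀ i : Fin n, (sortedDist (Finset.univ.val.map y) C).getD i 0 =
        Metric.infDist (y (σ i)) (C : Set (EuclideanSpace ℝ (Fin d))) := by
  let b : Fin n → ℝ := fun i => Metric.infDist (y i) (C : Set (EuclideanSpace ℝ (Fin d)))
  let σ := Tuple.sort fun i => OrderDual.toDual (b i)
  have hσ : Antitone (b ∘ σ) := Tuple.monotone_sort fun i => OrderDual.toDual (b i)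
  have hperm : (List.ofFn (b ∘ σ) : Multiset ℝ) = Finset.univ.val.map b := by
    rw [List.ofFn_eq_map, ← Multiset.map_coe]
    exact (Multiset.map_map b σ _).symm.trans (congrArg _ (Multiset.map_univ_val_equiv σ))
  have hsort : sortedDist (Finset.univ.val.map y) C = List.ofFn (b ∘ σ) := by
    refine List.Perm.eq_of_pairwise (le := (· ≥ ·)) (fun _ _ _ _ h₁ h₂ => le_antisymm h₂ h₁)
      (Multiset.pairwise_sort _ _) (List.pairwise_ofFn.2 fun _ _ hij => hσ hij.le) ?_
    rw [← Multiset.coe_eq_coe, hperm, sortedDist, Multiset.sort_eq, Multiset.map_map]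
    rfl
  refine ⟨σ, hσ, fun i => ?_⟩
  rw [hsort, List.getD_eq_getElem _ _ (by simp), List.getElem_ofFn, Function.comp_apply]

theorem isGreatest_cost (y : Fin n → EuclideanSpace ℝ (Fin d))
    (C : Finset (EuclideanSpace ℝ (Fin d))) {v : Fin n → ℝ} (hv : Antitone v) :
    IsGreatest (Set.range fun σ : Equiv.Perm (Fin n) =>
      ∑ i, v i * Metric.infDist (y (σ i)) (C : Set (EuclideanSpace ℝ (Fin d))))
      (cost v (Finset.univ.val.map y) C) := by
  obtain ⟨σ, hσ, hs⟩ := exists_perm_sortedDist y C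
  simp only [cost, hs]
  refine ⟨⟨σ, rfl⟩, ?_⟩
  rintro _ ⟨τ, rfl⟩
  simpa using (hv.monovary hσ).sum_mul_comp_perm_le_sum_mul (σ := τ.trans σ.symm)

theorem cost_le_cost_add {x y : Fin n → EuclideanSpace ℝ (Fin d)}
    (C : Finset (EuclideanSpace ℝ (Fin d))) {v : Fin n → ℝ} (hv : Antitone v)
    (hv0 : ∀ i, 0 ≤ v i) {e : ℝ}
    (he : ∀ σ : Equiv.Perm (Fin n), ∑ i, v i * dist (x (σ i)) (y (σ i)) ≤ e) :
    cost v (Finset.univ.val.map x) C ≤ cost v (Finset.univ.val.map y) C + e := by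
  obtain ⟨σ, hσ⟩ := (isGreatest_cost x C hv).1
  calc cost v (Finset.univ.val.map x) C
      = ∑ i, v i * Metric.infDist (x (σ i)) (C : Set (EuclideanSpace ℝ (Fin d))) := hσ.symm
    _ ≤ ∑ i, v i * (Metric.infDist (y (σ i)) (C : Set (EuclideanSpace ℝ (Fin d))) +
          dist (x (σ i)) (y (σ i))) := Finset.sum_le_sum fun i _ =>
        mul_le_mul_of_nonneg_left Metric.infDist_le_infDist_add_dist (hv0 i)
    _ = ∑ i, v i * Metric.infDist (y (σ i)) (C : Set (EuclideanSpace ℝ (Fin d))) +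
          ∑ i, v i * dist (x (σ i)) (y (σ i)) := by
        simp only [mul_add, Finset.sum_add_distrib]
    _ ≤ _ := add_le_add ((isGreatest_cost y C hv).2 ⟨σ, rfl⟩) (he σ)

theorem isSimultaneousCoreset_of_sum_mul_dist_le {k : ℕ} {ε : ℝ}
    {x y : Fin n → EuclideanSpace ℝ (Fin d)}
    (h : ∀ C : Finset (EuclideanSpace ℝ (Fin d)), C.card = k →
      ∀ v : Fin n → ℝ, Antitone v → (∀ i, 0 ≤ v i) → ∀ σ : Equiv.Perm (Fin n),
        ∑ i, v i * dist (x (σ i)) (y (σ i)) ≤ ε * cost v (Finset.univ.val.map x) C) :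
    IsSimultaneousCoreset k ε (Finset.univ.val.map x) (Finset.univ.val.map y) := by
  refine ⟨by simp, fun C hC => ?_⟩
  rw [show (Finset.univ.val.map x).card = n by simp]
  intro v hv hv0
  have hle := cost_le_cost_add C hv hv0 (h C hC v hv hv0)
  have hge := cost_le_cost_add (x := y) C hv hv0 fun σ => by
    simpa only [dist_comm (y _)] using h C hC v hv hv0 σ
  constructor <;> linarith

end Cost

section HeavyBalls

variable {ι E : Type*} [PseudoMetricSpace E]

/-- The squared distance of two points of an indexed family: the square root is not available to
the algorithm, which therefore works with squared distances throughout. -/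
def sqDist (x : ι → E) (i j : ι) : ℝ := dist (x i) (x j) ^ 2

theorem sqDist_nonneg (x : ι → E) (i j : ι) : 0 ≤ sqDist x i j := sq_nonneg _

theorem sqDist_self (x : ι → E) (i : ι) : sqDist x i i = 0 := by simp [sqDist]

/-- The points of `U` in the closed ball around `x a` with `x b` on its boundary. -/
def ballIn (x : ι → E) (U : Finset ι) (a b : ι) : Finset ι :=
  U.filter fun i => sqDist x a i ≤ sqDist x a b

theorem ballIn_subset (x : ι → E) (U : Finset ι) (a b : ι) : ballIn x U a b ⊆ U :=
  Finset.filter_subset _ _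

theorem card_sdiff_ballIn_lt [DecidableEq ι] (x : ι → E) {U : Finset ι} {a : ι} (ha : a ∈ U)
    (b : ι) : (U \ ballIn x U a b).card < U.card :=
  Finset.card_lt_card <| Finset.sdiff_ssubset (ballIn_subset x U a b)
    ⟨a, Finset.mem_filter.2 ⟨ha, (sqDist_self x a).trans_le (sqDist_nonneg x a b)⟩⟩

/-- The ball around `x a` through `x b` contains at least a `1 / (2 k)` fraction of `U`. -/
def Heavy (x : ι → E) (k : ℕ) (U : Finset ι) (a b : ι) : Prop :=
  a ∈ U ∧ b ∈ U ∧ U.card ≤ 2 * k * (ballIn x U a b).card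

/-- The ball around `x a` through `x b` is a heavy ball of least radius. -/
def IsLeastHeavy (x : ι → E) (k : ℕ) (U : Finset ι) (a b : ι) : Prop :=
  Heavy x k U a b ∧ ∀ a' b', Heavy x k U a' b' → sqDist x a b ≤ sqDist x a' b'

/-- The indices of the points at distance more than `r` from the center set `C`. -/
def outliers [Fintype ι] (x : ι → E) (C : Finset E) (r : ℝ) : Finset ι :=
  Finset.univ.filter fun i => r < Metric.infDist (x i) (C : Set E)

theorem exists_heavy (x : ι → E) {k : ℕ} (hk : 1 ≤ k) {U : Finset ι} (hU : U.Nonempty) :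
    ∃ a b, Heavy x k U a b := by
  obtain ⟨a, ha⟩ := hU
  obtain ⟨b, hb, hmax⟩ := Finset.exists_max_image U (sqDist x a) ⟨a, ha⟩
  refine ⟨a, b, ha, hb, ?_⟩
  rw [ballIn, Finset.filter_true_of_mem hmax]
  exact Nat.le_mul_of_pos_left _ (by omega)

theorem exists_heavy_of_dist_le (x : ι → E) {k : ℕ} {U Z : Finset ι} (hZU : Z ⊆ U)
    (hZne : Z.Nonempty) (hcard : U.card ≤ 2 * k * Z.card) (c : E) {r : ℝ}
    (hZ : ∀ i ∈ Z, dist (x i) c ≤ r) :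
    ∃ a b, Heavy x k U a b ∧ sqDist x a b ≤ (2 * r) ^ 2 := by
  obtain ⟨a, ha⟩ := hZne
  obtain ⟨b, hb, hmax⟩ := Finset.exists_max_image Z (sqDist x a) ⟨a, ha⟩
  have hsub : Z ⊆ ballIn x U a b := fun i hi => Finset.mem_filter.2 ⟨hZU hi, hmax i hi⟩
  refine ⟨a, b, ⟨hZU ha, hZU hb, hcard.trans ?_⟩, pow_le_pow_left₀ dist_nonneg ?_ 2⟩
  · exact Nat.mul_le_mul_left _ (Finset.card_le_card hsub)
  · linarith [dist_triangle_right (x a) (x b) c, hZ a ha, hZ b hb]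

theorem exists_card_le_mul_card_filter_dist_le (x : ι → E) (W : Finset ι) {C : Finset E}
    (hC : C.Nonempty) {r : ℝ} (hW : ∀ i ∈ W, Metric.infDist (x i) (C : Set E) ≤ r) :
    ∃ c, W.card ≤ C.card * (W.filter fun i => dist (x i) c ≤ r).card := by
  classical
  choose c hcC hc using fun i => C.finite_toSet.isCompact.exists_infDist_eq_dist
    (Finset.coe_nonempty.2 hC) (x i)
  have hC0 : (0 : ℚ) < C.card := by exact_mod_cast hC.card_pos
  obtain ⟨e, -, he⟩ := Finset.exists_le_card_fiber_of_nsmul_le_card_of_maps_to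
    (f := c) (fun i (_ : i ∈ W) => hcC i) hC
    (show C.card • ((W.card : ℚ) / C.card) ≤ W.card by
      rw [nsmul_eq_mul, mul_div_cancel₀ _ hC0.ne'])
  have hle : W.card ≤ C.card * (W.filter fun i => c i = e).card := by
    rw [div_le_iff₀' hC0] at he
    exact_mod_cast he
  refine ⟨e, hle.trans (Nat.mul_le_mul_left _ (Finset.card_le_card fun i hi => ?_))⟩
  obtain ⟨hiW, rfl⟩ := Finset.mem_filter.1 hi
  exact Finset.mem_filter.2 ⟨hiW, hc i ▸ hW i hiW⟩

theorem exists_heavy_le_of_card_outliers_le [Fintype ι] (x : ι → E) {k : ℕ} (hk : 1 ≤ k)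
    {U : Finset ι} (hU : U.Nonempty) {C : Finset E} (hC : C.card = k) {r : ℝ}
    (hout : (outliers x C r).card ≤ U.card / 2) :
    ∃ a b, Heavy x k U a b ∧ sqDist x a b ≤ (2 * r) ^ 2 := by
  classical
  have hCne : C.Nonempty := Finset.card_pos.1 (by omega)
  have hinner : U.card ≤ 2 * (U \ outliers x C r).card := by
    have := Finset.le_card_sdiff (outliers x C r) U
    omega
  obtain ⟨c, hc⟩ := exists_card_le_mul_card_filter_dist_le x (U \ outliers x C r) hCne
    (r := r) fun i hi => not_lt.1 fun hr =>
      (Finset.mem_sdiff.1 hi).2 (Finset.mem_filter.2 ⟨Finset.mem_univ i, hr⟩)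
  set Z := (U \ outliers x C r).filter fun i => dist (x i) c ≤ r
  rw [hC] at hc
  have hcard : U.card ≤ 2 * k * Z.card := by
    rw [mul_assoc]
    exact hinner.trans (Nat.mul_le_mul_left 2 hc)
  refine exists_heavy_of_dist_le x ((Finset.filter_subset _ _).trans Finset.sdiff_subset)
    (Finset.card_pos.1 <| Nat.pos_of_ne_zero fun h0 => ?_) hcard c
    fun i hi => (Finset.mem_filter.1 hi).2
  rw [h0, mul_zero] at hcard
  exact absurd hU.card_pos (by omega)

end HeavyBalls

section Peeling

/-- What a peeling process notes down about a point when it removes it: the number of the round,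
the number of points left before that round, and the center and squared radius of the removed
ball. -/
structure PeelEntry (ι : Type*) where
  round : ℕ
  remaining : ℕ
  center : ι
  sqRadius : ℝ

variable {ι E : Type*} [Fintype ι] [DecidableEq ι] [PseudoMetricSpace E]

/-- `IsPeeling x k N U log`: removing heavy balls of least radius for `N` rounds leaves `U`, and
`log` holds the entries of the removed points. The entries of the points in `U` are arbitrary, as
is the content of memory that has not been written yet. -/
inductive IsPeeling (x : ι → E) (k : ℕ) : ℕ → Finset ι → (ι → PeelEntry ι) → Prop
  | start (log) : IsPeeling x k 0 Finset.univ log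
  | step {N U log a b} : IsPeeling x k N U log → IsLeastHeavy x k U a b →
      IsPeeling x k (N + 1) (U \ ballIn x U a b)
        ((ballIn x U a b).piecewise (fun _ => ⟨N, U.card, a, sqDist x a b⟩) log)

namespace IsPeeling

variable {x : ι → E} {k N : ℕ} {U : Finset ι} {log : ι → PeelEntry ι}

/-- Every property of the entries can be checked at the moment when the entry is written. -/
theorem entry_induction {P : ι → PeelEntry ι → Prop} (h : IsPeeling x k N U log)
    (hP : ∀ N U a b, IsLeastHeavy x k U a b → ∀ i ∈ ballIn x U a b,
      P i ⟨N, U.card, a, sqDist x a b⟩) {i : ι} (hi : i ∉ U) : P i (log i) := by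
  induction h with
  | start => exact absurd (Finset.mem_univ i) hi
  | @step N U log a b _ hab ih =>
    by_cases hiB : i ∈ ballIn x U a b
    · rw [Finset.piecewise_eq_of_mem _ _ _ hiB]
      exact hP N U a b hab i hiB
    · rw [Finset.piecewise_eq_of_notMem _ _ _ hiB]
      exact ih fun hiU => hi (Finset.mem_sdiff.2 ⟨hiU, hiB⟩)

theorem sqRadius_nonneg (h : IsPeeling x k N U log) {i : ι} (hi : i ∉ U) :
    0 ≤ (log i).sqRadius :=
  h.entry_induction (P := fun _ e => 0 ≤ e.sqRadius) (fun _ _ _ _ _ _ _ => sqDist_nonneg _ _ _) hi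

theorem sqDist_center_le (h : IsPeeling x k N U log) {i : ι} (hi : i ∉ U) :
    sqDist x (log i).center i ≤ (log i).sqRadius :=
  h.entry_induction (P := fun i e => sqDist x e.center i ≤ e.sqRadius)
    (fun _ _ _ _ _ _ hiB => (Finset.mem_filter.1 hiB).2) hi

theorem sqRadius_le (hk : 1 ≤ k) (h : IsPeeling x k N U log) {i : ι} (hi : i ∉ U)
    {C : Finset E} (hC : C.card = k) {r : ℝ}
    (hout : (outliers x C r).card ≤ (log i).remaining / 2) :
    (log i).sqRadius ≤ (2 * r) ^ 2 := by
  refine h.entry_induction (P := fun _ e =>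
    (outliers x C r).card ≤ e.remaining / 2 → e.sqRadius ≤ (2 * r) ^ 2)
    (fun _ U a b hab i hiB hout => ?_) hi hout
  obtain ⟨a', b', hab', hle⟩ :=
    exists_heavy_le_of_card_outliers_le x hk ⟨i, ballIn_subset x U a b hiB⟩ hC hout
  exact (hab.2 a' b' hab').trans hle

theorem round_lt (h : IsPeeling x k N U log) {i : ι} (hi : i ∉ U) : (log i).round < N := by
  induction h with
  | start => exact absurd (Finset.mem_univ i) hi
  | @step N U log a b _ _ ih =>
    by_cases hiB : i ∈ ballIn x U a b
    · simp only [Finset.piecewise_eq_of_mem _ _ _ hiB, Nat.lt_succ_self]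
    · rw [Finset.piecewise_eq_of_notMem _ _ _ hiB]
      exact (ih fun hiU => hi (Finset.mem_sdiff.2 ⟨hiU, hiB⟩)).trans (Nat.lt_succ_self N)

theorem entry_eq_of_round_eq (h : IsPeeling x k N U log) {i j : ι} (hi : i ∉ U) (hj : j ∉ U)
    (hij : (log i).round = (log j).round) : log i = log j := by
  induction h with
  | start => exact absurd (Finset.mem_univ i) hi
  | @step N U log a b h _ ih =>
    have old : ∀ {l}, l ∉ U \ ballIn x U a b → l ∉ ballIn x U a b → l ∉ U := fun hl hlB hlU =>
      hl (Finset.mem_sdiff.2 ⟨hlU, hlB⟩)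
    by_cases hiB : i ∈ ballIn x U a b <;> by_cases hjB : j ∈ ballIn x U a b <;>
      simp only [Finset.piecewise, hiB, hjB, if_true, if_false] at hij ⊢
    · exact absurd hij.symm (h.round_lt (old hj hjB)).ne
    · exact absurd hij (h.round_lt (old hi hiB)).ne
    · exact ih (old hi hiB) (old hj hjB) hij

theorem card_lt_remaining (h : IsPeeling x k N U log) {i : ι} (hi : i ∉ U) :
    U.card < (log i).remaining := by
  induction h with
  | start => exact absurd (Finset.mem_univ i) hi
  | @step N U log a b _ hab ih =>
    have hlt := card_sdiff_ballIn_lt x hab.1.1 b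
    by_cases hiB : i ∈ ballIn x U a b
    · rwa [Finset.piecewise_eq_of_mem _ _ _ hiB]
    · rw [Finset.piecewise_eq_of_notMem _ _ _ hiB]
      exact hlt.trans (ih fun hiU => hi (Finset.mem_sdiff.2 ⟨hiU, hiB⟩))

theorem card_filter_remaining_add_card_le (h : IsPeeling x k N U log) {i : ι} (hi : i ∉ U) :
    (Uᶜ.filter fun j => (log j).remaining ≤ (log i).remaining).card + U.card ≤
      (log i).remaining := by
  induction h with
  | start => exact absurd (Finset.mem_univ i) hi
  | @step N U log a b h _ ih =>
    set B := ballIn x U a b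
    set w := (B.piecewise (fun _ => ⟨N, U.card, a, sqDist x a b⟩) log i).remaining with hw
    have hold : (Uᶜ.filter fun j => (log j).remaining ≤ w).card + U.card ≤ w := by
      by_cases hiB : i ∈ B
      · rw [hw, Finset.piecewise_eq_of_mem _ _ _ hiB, Finset.filter_false_of_mem fun j hj =>
          not_le.2 (h.card_lt_remaining (Finset.mem_compl.1 hj)), Finset.card_empty, zero_add]
      · rw [hw, Finset.piecewise_eq_of_notMem _ _ _ hiB]
        exact ih fun hiU => hi (Finset.mem_sdiff.2 ⟨hiU, hiB⟩)
    have hsub : ((U \ B)ᶜ.filter fun j =>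
        (B.piecewise (fun _ => ⟨N, U.card, a, sqDist x a b⟩) log j).remaining ≤ w) ⊆
        (Uᶜ.filter fun j => (log j).remaining ≤ w) ∪ B := fun j hj => by
      by_cases hjB : j ∈ B
      · exact Finset.mem_union_right _ hjB
      · obtain ⟨hjU, hjw⟩ := Finset.mem_filter.1 hj
        rw [Finset.piecewise_eq_of_notMem _ _ _ hjB] at hjw
        exact Finset.mem_union_left _ <| Finset.mem_filter.2 ⟨Finset.mem_compl.2 fun hjU' =>
          Finset.mem_compl.1 hjU (Finset.mem_sdiff.2 ⟨hjU', hjB⟩), hjw⟩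
    have := (Finset.card_le_card hsub).trans (Finset.card_union_le _ _)
    have := Finset.card_sdiff_add_card_eq_card (show B ⊆ U from ballIn_subset x U a b)
    omega

theorem round_le_of_nonempty (h : IsPeeling x k N U log) (hU : U.Nonempty) :
    (N : ℝ) ≤ 2 * k * (Real.log (Fintype.card ι) - Real.log U.card) := by
  induction h with
  | start => simp
  | @step N U _ a b _ hab ih =>
    have hUcard : (0 : ℝ) < U.card :=
      Nat.cast_pos.2 (hU.mono Finset.sdiff_subset).card_pos
    set B := ballIn x U a b
    have hcard : ((U \ B).card : ℝ) + B.card = U.card := by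
      exact_mod_cast Finset.card_sdiff_add_card_eq_card (ballIn_subset x U a b)
    have hpos : (0 : ℝ) < (U \ B).card := Nat.cast_pos.2 hU.card_pos
    have hheavy : (U.card : ℝ) ≤ 2 * k * B.card := by exact_mod_cast hab.1.2.2
    have hlog : (B.card : ℝ) / U.card ≤ Real.log U.card - Real.log (U \ B).card := by
      have h := Real.log_le_sub_one_of_pos (div_pos hpos hUcard)
      rw [Real.log_div hpos.ne' hUcard.ne'] at h
      rw [eq_sub_of_add_eq' hcard, sub_div, div_self hUcard.ne']
      linarith
    have hone : 1 ≤ 2 * (k : ℝ) * (B.card / U.card) := by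
      rwa [← mul_div_assoc, one_le_div hUcard]
    have hgain : 2 * (k : ℝ) * (B.card / U.card) ≤
        2 * k * (Real.log U.card - Real.log (U \ B).card) := by gcongr
    push_cast
    linarith [ih (hU.mono Finset.sdiff_subset)]

theorem round_le (h : IsPeeling x k N U log) :
    (N : ℝ) ≤ 2 * k * Real.log (Fintype.card ι) + 1 := by
  cases h with
  | start =>
    rw [Nat.cast_zero]
    positivity
  | @step N U log a b h hab =>
    have hN := h.round_le_of_nonempty ⟨a, hab.1.1⟩
    have hU : 0 ≤ 2 * k * Real.log U.card := by positivity
    push_cast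
    linarith

end IsPeeling

end Peeling

section Coreset

variable {d n k N : ℕ} {x : Fin n → EuclideanSpace ℝ (Fin d)} {U : Finset (Fin n)}
  {log : Fin n → PeelEntry (Fin n)}

theorem card_outliers_sortedDist_le (x : Fin n → EuclideanSpace ℝ (Fin d))
    (C : Finset (EuclideanSpace ℝ (Fin d))) (w : ℕ) :
    (outliers x C ((sortedDist (Finset.univ.val.map x) C).getD w 0)).card ≤ w := by
  obtain ⟨σ, -, hs⟩ := exists_perm_sortedDist x C
  have hsub : outliers x C ((sortedDist (Finset.univ.val.map x) C).getD w 0) ⊆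
      (Finset.univ.filter fun i : Fin n => (i : ℕ) < w).map σ.toEmbedding := fun i hi => by
    rw [outliers, Finset.mem_filter, ← σ.apply_symm_apply i, ← hs] at hi
    refine Finset.mem_map.2 ⟨σ.symm i, Finset.mem_filter.2 ⟨Finset.mem_univ _, ?_⟩, by simp⟩
    exact (antitone_sortedDist_getD _ C).reflect_lt hi.2
  calc _ ≤ _ := Finset.card_le_card hsub
    _ ≤ w := by
      rw [Finset.card_map, Fin.card_filter_val_lt]
      exact min_le_right _ _

theorem IsPeeling.dist_le (hk : 1 ≤ k) (h : IsPeeling x k N U log)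
    {C : Finset (EuclideanSpace ℝ (Fin d))} (hC : C.card = k) {ε : ℝ} (hε : 0 ≤ ε) {i : Fin n}
    (hi : i ∉ U) {y : EuclideanSpace ℝ (Fin d)}
    (hy : dist (x i) y ^ 2 ≤ ε ^ 2 / 16 * (log i).sqRadius) :
    dist (x i) y ≤
      ε / 2 * (sortedDist (Finset.univ.val.map x) C).getD ((log i).remaining / 2) 0 := by
  have hs := sortedDist_getD_nonneg (Finset.univ.val.map x) C ((log i).remaining / 2)
  have hrad := h.sqRadius_le hk hi hC (card_outliers_sortedDist_le x C _)
  set s := (sortedDist (Finset.univ.val.map x) C).getD ((log i).remaining / 2) 0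
  refine abs_le_of_sq_le_sq' ?_ (by positivity) |>.2
  calc _ ≤ ε ^ 2 / 16 * (2 * s) ^ 2 := hy.trans (by gcongr)
    _ = (ε / 2 * s) ^ 2 := by ring

theorem IsPeeling.isSimultaneousCoreset (hk : 1 ≤ k) (h : IsPeeling x k N ∅ log) {ε : ℝ}
    (hε : 0 ≤ ε) {y : Fin n → EuclideanSpace ℝ (Fin d)}
    (hy : ∀ i, dist (x i) (y i) ^ 2 ≤ ε ^ 2 / 16 * (log i).sqRadius) :
    IsSimultaneousCoreset k ε (Finset.univ.val.map x) (Finset.univ.val.map y) := by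
  refine isSimultaneousCoreset_of_sum_mul_dist_le fun C hC v hv hv0 σ => ?_
  set s := fun w => (sortedDist (Finset.univ.val.map x) C).getD w 0
  have hs : Antitone fun w => s (w / 2) := (antitone_sortedDist_getD _ C).comp_monotone
    fun _ _ hab => Nat.div_le_div_right hab
  have hrem : ∀ i, (Finset.univ.filter fun j => (log j).remaining ≤ (log i).remaining).card ≤
      (log i).remaining := fun i => by
    simpa using h.card_filter_remaining_add_card_le (Finset.notMem_empty i)
  calc ∑ i, v i * dist (x (σ i)) (y (σ i))
      ≤ ∑ i, v i * (ε / 2 * s ((log (σ i)).remaining / 2)) := Finset.sum_le_sum fun i _ =>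
        mul_le_mul_of_nonneg_left (h.dist_le hk hC hε (Finset.notMem_empty _) (hy _)) (hv0 i)
    _ = ε / 2 * ∑ i, v i * s ((log (σ i)).remaining / 2) := by
        simp only [Finset.mul_sum, mul_left_comm]
    _ ≤ ε / 2 * ∑ i : Fin n, v i * s (i / 2) := by
        gcongr _ * ?_
        exact sum_mul_comp_le hv hv0 hrem hs σ
    _ ≤ ε / 2 * (2 * ∑ i : Fin n, v i * s i) := by
        gcongr _ * ?_
        exact sum_mul_half_le hv hv0 (sortedDist_getD_nonneg _ C)
    _ = ε * cost v (Finset.univ.val.map x) C := by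
        rw [cost]
        ring

theorem IsPeeling.card_filter_round_le (h : IsPeeling x k N ∅ log) {ε : ℝ} (hε : 0 < ε)
    (hε1 : ε ≤ 1) {S : Finset (Fin n)}
    (hS : (S : Set (Fin n)).Pairwise fun i j =>
      ε ^ 2 / 16 * min (log i).sqRadius (log j).sqRadius < sqDist x i j) (t : ℕ) :
    ((S.filter fun i => (log i).round = t).card : ℝ) ≤ (9 / ε) ^ d := by
  rcases (S.filter fun i => (log i).round = t).eq_empty_or_nonempty with hemp | ⟨a, ha⟩
  · rw [hemp, Finset.card_empty, Nat.cast_zero]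
    positivity
  have hlog : ∀ i ∈ S.filter fun i => (log i).round = t, log i = log a := fun i hi =>
    h.entry_eq_of_round_eq (Finset.notMem_empty i) (Finset.notMem_empty a)
      ((Finset.mem_filter.1 hi).2.trans (Finset.mem_filter.1 ha).2.symm)
  have hsq : √(log a).sqRadius ^ 2 = (log a).sqRadius :=
    Real.sq_sqrt (h.sqRadius_nonneg (Finset.notMem_empty a))
  have hpack := card_le_of_pairwise_mul_lt_dist (S.filter fun i => (log i).round = t) x
    (x (log a).center) (Real.sqrt_nonneg (log a).sqRadius) (show 0 < ε / 4 by positivity)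
    (fun i hi => by
      rw [dist_comm, ← hlog i hi]
      exact Real.le_sqrt_of_sq_le (h.sqDist_center_le (Finset.notMem_empty i)))
    (fun i hi j hj hij => by
      have hsep := hS (Finset.mem_filter.1 hi).1 (Finset.mem_filter.1 hj).1 hij
      beta_reduce at hsep ⊢
      rw [hlog i hi, hlog j hj, min_self, ← hsq] at hsep
      refine lt_of_pow_lt_pow_left₀ 2 dist_nonneg (lt_of_eq_of_lt ?_ hsep)
      ring)
  rw [finrank_euclideanSpace_fin] at hpack
  refine hpack.trans (pow_le_pow_left₀ (by positivity) ?_ d)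
  rw [le_div_iff₀ hε]
  field_simp
  linarith

theorem half_le_log {n : ℕ} (hn : 2 ≤ n) : 1 / 2 ≤ Real.log n :=
  calc (1 / 2 : ℝ) ≤ Real.log 2 := by linarith [Real.log_two_gt_d9]
    _ ≤ Real.log n := Real.log_le_log two_pos (by exact_mod_cast hn)

theorem IsPeeling.card_le_of_pairwise (hn : 2 ≤ n) (hd : 1 ≤ d) (hk : 1 ≤ k)
    (h : IsPeeling x k N ∅ log) {ε : ℝ} (hε : 0 < ε) (hε1 : ε ≤ 1) {S : Finset (Fin n)}
    (hS : (S : Set (Fin n)).Pairwise fun i j =>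
      ε ^ 2 / 16 * min (log i).sqRadius (log j).sqRadius < sqDist x i j) :
    (S.card : ℝ) ≤ 36 ^ d * (k * Real.log n / ε ^ d) := by
  have hsum : (S.card : ℝ) ≤ N * (9 / ε) ^ d := by
    rw [Finset.card_eq_sum_card_fiberwise (f := fun i => (log i).round) (t := Finset.range N)
      fun i _ => by simpa using h.round_lt (Finset.notMem_empty i), Nat.cast_sum]
    exact (Finset.sum_le_sum fun t _ => h.card_filter_round_le hε hε1 hS t).trans_eq (by simp)
  have hN : (N : ℝ) ≤ 4 * (k * Real.log n) := by
    have hround := h.round_le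
    rw [Fintype.card_fin] at hround
    have hk1 : (1 : ℝ) ≤ k := by exact_mod_cast hk
    nlinarith [half_le_log hn]
  calc (S.card : ℝ) ≤ 4 * (k * Real.log n) * (9 / ε) ^ d := hsum.trans (by gcongr)
    _ ≤ 4 ^ d * (k * Real.log n) * (9 / ε) ^ d := by
        gcongr
        exact le_self_pow₀ (by norm_num) (by omega)
    _ = _ := by
        rw [show (36 : ℝ) = 4 * 9 by norm_num, mul_pow, div_pow]
        ring

end Coreset

section Net

variable {E : Type*} [PseudoMetricSpace E] {n : ℕ} {x : Fin n → E} {ρ : Fin n → ℝ} {t R r : ℕ}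
  {rep : ℕ → Fin n} {asg : Fin n → ℕ} {p : Fin n}

/-- A net of the first `t` points with respect to the squared radii `ρ`: the representatives are
`rep 0, …, rep (R - 1)`, and the point `i` is assigned to `rep (asg i)`. -/
structure IsNet (x : Fin n → E) (ρ : Fin n → ℝ) (t R : ℕ) (rep : ℕ → Fin n) (asg : Fin n → ℕ) :
    Prop where
  le : R ≤ t
  rep_lt : ∀ r < R, (rep r : ℕ) < t
  asg_lt : ∀ i : Fin n, (i : ℕ) < t → asg i < R
  asg_rep : ∀ r < R, asg (rep r) = r
  near : ∀ i : Fin n, (i : ℕ) < t → sqDist x i (rep (asg i)) ≤ ρ i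
  sep : ∀ r < R, ∀ r' < R, r ≠ r' → min (ρ (rep r)) (ρ (rep r')) < sqDist x (rep r) (rep r')

theorem sqDist_comm (x : Fin n → E) (i j : Fin n) : sqDist x i j = sqDist x j i := by
  simp only [sqDist, dist_comm]

theorem IsNet.empty (x : Fin n → E) (ρ : Fin n → ℝ) (rep : ℕ → Fin n) (asg : Fin n → ℕ) :
    IsNet x ρ 0 0 rep asg := by
  constructor <;> simp

theorem IsNet.join (h : IsNet x ρ p R rep asg) (hr : r < R) (hnear : sqDist x p (rep r) ≤ ρ p) :
    IsNet x ρ (p + 1) R rep (Function.update asg p r) where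
  le := h.le.trans p.1.le_succ
  rep_lt r hr := (h.rep_lt r hr).trans p.1.lt_succ_self
  asg_lt i hi := by
    have := h.asg_lt i
    grind
  asg_rep r' hr' := by
    have := h.rep_lt r'
    grind [h.asg_rep r']
  near i hi := by grind [h.near i]
  sep := h.sep

theorem IsNet.insert (h : IsNet x ρ p R rep asg) (hρ : 0 ≤ ρ p)
    (hfar : ∀ r < R, ρ p < sqDist x p (rep r)) :
    IsNet x ρ (p + 1) (R + 1) (Function.update rep R p) (Function.update asg p R) where
  le := Nat.succ_le_succ h.le
  rep_lt r hr := by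
    have := h.rep_lt r
    grind
  asg_lt i hi := by
    have := h.asg_lt i
    grind
  asg_rep r hr := by
    have := h.rep_lt r
    grind [h.asg_rep r]
  near i hi := by grind [h.asg_lt i, h.near i, sqDist_self]
  sep r hr r' hr' hrr' := by grind [h.sep r, hfar r, hfar r', sqDist_comm]

theorem IsNet.injOn (h : IsNet x ρ t R rep asg) (hρ : ∀ i, 0 ≤ ρ i) :
    Set.InjOn (fun r => x (rep r)) (Finset.range R) := by
  intro r hr r' hr' he
  by_contra hne
  have hsep := h.sep r (Finset.mem_range.1 hr) r' (Finset.mem_range.1 hr') hne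
  rw [sqDist, show x (rep r) = x (rep r') from he, dist_self, zero_pow two_ne_zero] at hsep
  exact hsep.not_ge (le_min (hρ _) (hρ _))

/-- The number of those among the first `t` points that are assigned to `rep r`. -/
def load (asg : Fin n → ℕ) (t r : ℕ) : ℕ :=
  (Finset.univ.filter fun i : Fin n => (i : ℕ) < t ∧ asg i = r).card

theorem load_update_self (asg : Fin n → ℕ) (p : Fin n) (r : ℕ) :
    load (Function.update asg p r) (p + 1) r = load asg p r + 1 := by
  rw [load, load, ← Finset.card_insert_of_notMem (a := p) (by simp)]
  congr 1
  grind

theorem load_update_of_ne (asg : Fin n → ℕ) (p : Fin n) {r r' : ℕ} (hr : r' ≠ r) :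
    load (Function.update asg p r) (p + 1) r' = load asg p r' := by
  rw [load, load]
  congr 1
  grind

theorem IsNet.load_eq_zero (h : IsNet x ρ t R rep asg) : load asg t R = 0 := by
  rw [load, Finset.card_eq_zero, Finset.filter_eq_empty_iff]
  rintro i - ⟨hi, hr⟩
  exact (h.asg_lt i hi).ne hr

/-- The search for a representative close to the point `p` among the first `R` ones may return `c`:
`0` if there is none, `r + 1` if `rep r` is close. -/
def IsMatch (x : Fin n → E) (ρ : Fin n → ℝ) (rep : ℕ → Fin n) (p : Fin n) (R c : ℕ) : Prop :=
  (c = 0 ∧ ∀ r < R, ρ p < sqDist x p (rep r)) ∨ ∃ r < R, c = r + 1 ∧ sqDist x p (rep r) ≤ ρ p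

theorem isMatch_succ (h : sqDist x p (rep R) ≤ ρ p) : IsMatch x ρ rep p (R + 1) (R + 1) :=
  Or.inr ⟨R, R.lt_succ_self, rfl, h⟩

theorem IsMatch.succ {c : ℕ} (hc : IsMatch x ρ rep p R c) (h : ρ p < sqDist x p (rep R)) :
    IsMatch x ρ rep p (R + 1) c := by
  rcases hc with ⟨hc, hfar⟩ | ⟨r, hr, hc, hnear⟩
  · exact Or.inl ⟨hc, fun r hr => (Nat.lt_succ_iff_lt_or_eq.1 hr).elim (hfar r) fun he => he ▸ h⟩
  · exact Or.inr ⟨r, hr.trans R.lt_succ_self, hc, hnear⟩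

end Net

end OrderedMedian

/-! ### Reasoning about programs -/

namespace RealRAM

attribute [local simp] Instr.run Test.Holds Function.update_apply

/-- The total correctness judgement: started in `s`, the program `p` halts after at most `T` steps
in a state with property `Q`. -/
def HaltsIn (p : Prog) (s : State) (T : ℕ) (Q : State → Prop) : Prop :=
  ∃ t s', Exec p s t s' ∧ t ≤ T ∧ Q s'

section HaltsIn

variable {c : Test} {p q : Prog} {s : State} {N T T' : ℕ} {Q R : State → Prop}
  {I : ℕ → State → Prop}

theorem HaltsIn.weaken {Q' : State → Prop} (h : HaltsIn p s T Q) (hT : T ≤ T')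
    (hQ : ∀ s', Q s' → Q' s') : HaltsIn p s T' Q' := by
  obtain ⟨t, s', he, ht, hq⟩ := h
  exact ⟨t, s', he, ht.trans hT, hQ s' hq⟩

theorem HaltsIn.skip (h : Q s) (hT : 1 ≤ T) : HaltsIn (.instr .skip) s T Q :=
  ⟨1, s, .instr .skip s, hT, h⟩

theorem HaltsIn.seq (h : HaltsIn p s T R) (h' : ∀ s', R s' → HaltsIn q s' T' Q) :
    HaltsIn (.seq p q) s (T + T') Q := by
  obtain ⟨t, s', he, ht, hr⟩ := h
  obtain ⟨t', s'', he', ht', hq⟩ := h' s' hr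
  exact ⟨t + t', s'', he.seq he', add_le_add ht ht', hq⟩

theorem HaltsIn.ite (hp : c.Holds s → HaltsIn p s T Q) (hq : ¬ c.Holds s → HaltsIn q s T Q) :
    HaltsIn (.ite c p q) s (T + 1) Q := by
  by_cases hc : c.Holds s
  · obtain ⟨t, s', he, ht, h⟩ := hp hc
    exact ⟨t + 1, s', he.iteTrue hc, by omega, h⟩
  · obtain ⟨t, s', he, ht, h⟩ := hq hc
    exact ⟨t + 1, s', he.iteFalse hc, by omega, h⟩

/-- Here the first argument of the invariant bounds the number of iterations to come. -/
theorem HaltsIn.while (htest : ∀ m s, I m s → (c.Holds s ↔ 0 < m))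
    (hbody : ∀ m, 0 < m → ∀ s, I m s → HaltsIn p s T fun s' => ∃ m' < m, I m' s')
    (m : ℕ) (hs : I m s) : HaltsIn (.while c p) s (m * (T + 1) + 1) (I 0) := by
  induction m using Nat.strong_induction_on generalizing s with
  | _ m ih =>
    rcases Nat.eq_zero_or_pos m with rfl | hm
    · exact ⟨1, s, .whileFalse (mt (htest 0 s hs).1 (lt_irrefl 0)), by omega, hs⟩
    · obtain ⟨t, s', he, ht, m', hm', hI'⟩ := hbody m hm s hs
      obtain ⟨t', s'', he', ht', hI''⟩ := ih m' hm' hI'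
      refine ⟨t + t' + 1, s'', .whileTrue ((htest m s hs).2 hm) he he', ?_, hI''⟩
      have hle : (m' + 1) * (T + 1) ≤ m * (T + 1) := Nat.mul_le_mul_right _ hm'
      rw [add_mul] at hle
      omega

/-- Here the first argument of the invariant counts the iterations done. -/
theorem HaltsIn.for (htest : ∀ i ≤ N, ∀ s, I i s → (c.Holds s ↔ i < N))
    (hbody : ∀ i < N, ∀ s, I i s → HaltsIn p s T (I (i + 1))) (hs : I 0 s) :
    HaltsIn (.while c p) s (N * (T + 1) + 1) (I N) := by
  refine (HaltsIn.while (I := fun m s => m ≤ N ∧ I (N - m) s) ?_ ?_ N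
    ⟨le_rfl, by simpa using hs⟩).weaken le_rfl fun s' h => by simpa using h.2
  · rintro m s ⟨hm, hI⟩
    rw [htest _ (by omega) s hI]
    omega
  · rintro m hm s ⟨hmN, hI⟩
    refine (hbody _ (by omega) s hI).weaken le_rfl fun s' hI' => ⟨m - 1, by omega, by omega, ?_⟩
    rwa [show N - (m - 1) = N - m + 1 by omega]

end HaltsIn

/-- Straight-line code. -/
def block : List Instr → Prog
  | [] => .instr .skip
  | i :: l => .seq (.instr i) (block l)

/-- The effect of straight-line code. -/
def runBlock (l : List Instr) (s : State) : State := l.foldl (fun s i => i.run s) s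

attribute [local simp] runBlock

theorem HaltsIn.block {l : List Instr} {s : State} {T : ℕ} {Q : State → Prop}
    (h : Q (runBlock l s)) (hT : l.length + 1 ≤ T) : HaltsIn (block l) s T Q := by
  suffices hexec : Exec (RealRAM.block l) s (l.length + 1) (runBlock l s) from ⟨_, _, hexec, hT, h⟩
  clear h hT
  induction l generalizing s with
  | nil => exact .instr .skip s
  | cons i l ih =>
    rw [List.length_cons, add_comm l.length 1, add_assoc]
    exact (Exec.instr i s).seq ih

/-- Agreement of two states on the natural registers below `L` and the real registers below `M`. -/
structure RegsEq (L M : ℕ) (s s' : State) : Prop where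
  nat : ∀ a < L, s'.natReg a = s.natReg a
  real : ∀ a < M, s'.realReg a = s.realReg a

/-- Agreement of two states on the memory, the natural registers below `L` and the real registers
below `M`: the frame condition of most programs below, which use high registers as scratch
space. -/
structure EqBelow (L M : ℕ) (s s' : State) : Prop extends RegsEq L M s s' where
  natMem : s'.natMem = s.natMem
  realMem : s'.realMem = s.realMem

/-- The instruction writes to no natural register below `L` and no real register below `M`. -/
def Instr.KeepsRegs (L M : ℕ) : Instr → Prop
  | .natConst a _ | .natAdd a _ _ | .natSub a _ _ | .natLoad a _ => L ≤ a
  | .realConst a _ | .realAdd a _ _ | .realSub a _ _ | .realMul a _ _ | .realDiv a _ _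
  | .realLoad a _ => M ≤ a
  | .skip | .natStore _ _ | .realStore _ _ => True

/-- The instruction does not write to the memory. -/
def Instr.KeepsMem : Instr → Prop
  | .natStore _ _ | .realStore _ _ => False
  | _ => True

attribute [local simp] Instr.KeepsRegs Instr.KeepsMem

section Frames

variable {L M L' M' : ℕ} {s s' s'' : State} {l : List Instr}

theorem RegsEq.trans (h : RegsEq L M s s') (h' : RegsEq L M s' s'') : RegsEq L M s s'' :=
  ⟨fun a ha => (h'.nat a ha).trans (h.nat a ha), fun a ha => (h'.real a ha).trans (h.real a ha)⟩

theorem RegsEq.natReg_eq {a v : ℕ} (h : RegsEq L M s s') (hv : s.natReg a = v)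
    (ha : a < L := by norm_num) : s'.natReg a = v :=
  (h.nat a ha).trans hv

theorem RegsEq.realReg_eq {a : ℕ} {v : ℝ} (h : RegsEq L M s s') (hv : s.realReg a = v)
    (ha : a < M := by norm_num) : s'.realReg a = v :=
  (h.real a ha).trans hv

theorem RegsEq.mono (h : RegsEq L M s s') (hL : L' ≤ L := by norm_num)
    (hM : M' ≤ M := by norm_num) : RegsEq L' M' s s' :=
  ⟨fun a ha => h.nat a (by omega), fun a ha => h.real a (by omega)⟩

theorem EqBelow.rfl : EqBelow L M s s :=
  ⟨⟨fun _ _ => Eq.refl _, fun _ _ => Eq.refl _⟩, Eq.refl _, Eq.refl _⟩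

theorem EqBelow.trans (h : EqBelow L M s s') (h' : EqBelow L M s' s'') : EqBelow L M s s'' :=
  ⟨h.toRegsEq.trans h'.toRegsEq, h'.natMem.trans h.natMem, h'.realMem.trans h.realMem⟩

theorem EqBelow.mono (h : EqBelow L M s s') (hL : L' ≤ L := by norm_num)
    (hM : M' ≤ M := by norm_num) : EqBelow L' M' s s' :=
  ⟨h.toRegsEq.mono hL hM, h.natMem, h.realMem⟩

theorem Instr.KeepsRegs.regsEq {i : Instr} (h : i.KeepsRegs L M) (s : State) :
    RegsEq L M s (i.run s) := by
  cases i <;> constructor <;> intro a ha <;> first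
    | rfl
    | exact Function.update_of_ne (ne_of_lt (lt_of_lt_of_le ha h)) _ _

theorem RegsEq.runBlock (h : ∀ i ∈ l, i.KeepsRegs L M) (s : State) :
    RegsEq L M s (runBlock l s) := by
  induction l generalizing s with
  | nil => exact EqBelow.rfl.toRegsEq
  | cons i l ih =>
    exact ((h i (by simp)).regsEq s).trans (ih (fun j hj => h j (by simp [hj])) _)

theorem EqBelow.runBlock (h : ∀ i ∈ l, i.KeepsRegs L M ∧ i.KeepsMem) (s : State) :
    EqBelow L M s (runBlock l s) := by
  induction l generalizing s with
  | nil => exact EqBelow.rfl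
  | cons i l ih =>
    have hi : EqBelow L M s (i.run s) := by
      refine ⟨(h i (by simp)).1.regsEq s, ?_, ?_⟩ <;>
      · have := (h i (by simp)).2
        cases i <;> first | rfl | exact this.elim
    exact hi.trans (ih (fun j hj => h j (by simp [hj])) _)

end Frames

/-! ### Registers, constants and loops over the points -/

local notation "dimReg" => 1
local notation "oneReg" => 3
local notation "lastReg" => 4
local notation "lastCoordReg" => 5
local notation "twoKReg" => 6
local notation "zeroReg" => 7
local notation "baseReg" => 8
local notation "coordReg" => 40
local notation "ptrReg₁" => 41
local notation "ptrReg₂" => 42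
local notation "scaleReg" => 1
local notation "coordValReg₁" => 40
local notation "coordValReg₂" => 41

/-- The registers that never change once they are set up: the dimension, the constants `0` and
`1`, the last index of a point, the last index of a coordinate, `2 k`, the first address behind the
coordinates of the points, and the factor `ε ^ 2 / 16` for squared radii. -/
structure Constants (n d k : ℕ) (ε : ℝ) (s : State) : Prop where
  dim : s.natReg dimReg = d
  one : s.natReg oneReg = 1
  last : s.natReg lastReg + 1 = n
  lastCoord : s.natReg lastCoordReg + 1 = d
  twoK : s.natReg twoKReg = 2 * k
  zero : s.natReg zeroReg = 0
  base : s.natReg baseReg = n * d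
  scale : s.realReg scaleReg = ε ^ 2 / 16

/-- Puts the squared distance of the points at the addresses in the registers `pa`, `pb` into the
real register `res`. -/
def distProg (pa pb res : ℕ) : Prog :=
  .seq (block [.natConst coordReg 0, .natAdd ptrReg₁ pa zeroReg, .natAdd ptrReg₂ pb zeroReg,
      .realConst res 0])
    (.while (.natLe coordReg lastCoordReg)
      (block [.realLoad coordValReg₁ ptrReg₁, .realLoad coordValReg₂ ptrReg₂,
        .realSub coordValReg₁ coordValReg₁ coordValReg₂,
        .realMul coordValReg₁ coordValReg₁ coordValReg₁, .realAdd res res coordValReg₁,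
        .natAdd ptrReg₁ ptrReg₁ oneReg, .natAdd ptrReg₂ ptrReg₂ oneReg,
        .natAdd coordReg coordReg oneReg]))

/-- Executes the body if the flag of the current point is `0`, and goes on to the next point. Index,
address and flag of the current point are in the registers `r`, `r + 1`, `r + 2`. -/
def visitUnflagged (r : ℕ) (body : Prog) : Prog :=
  .seq (block [.natLoad (r + 2) r])
    (.seq (.ite (.natLe (r + 2) zeroReg) body (.instr .skip))
      (block [.natAdd (r + 1) (r + 1) dimReg, .natAdd r r oneReg]))

/-- Executes the body for all points with flag `0`. -/
def forUnflagged (r : ℕ) (body : Prog) : Prog :=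
  .seq (block [.natConst r 0, .natConst (r + 1) 0])
    (.while (.natLe r lastReg) (visitUnflagged r body))

section Time

variable {S : Type*} [Semiring S]

/-! The time bounds are expressions over an arbitrary semiring: over `ℕ` they are numbers of steps,
over `ℕ[X]` they are the polynomials that bound these numbers. -/

/-- The running time of `distProg` in dimension `d`. -/
def distTime (d : S) : S := 10 * d + 6

/-- The running time of `forUnflagged` for `n` points and a body with running time `T`. -/
def loopTime (n T : S) : S := n * (T + 8) + 4

end Time

section Loops

variable {d n k : ℕ} {ε : ℝ} {s s' : State}

theorem Constants.congr (h : Constants n d k ε s) (e : RegsEq 9 2 s s') :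
    Constants n d k ε s' where
  dim := e.natReg_eq h.dim
  one := e.natReg_eq h.one
  last := by rw [e.natReg_eq rfl, h.last]
  lastCoord := by rw [e.natReg_eq rfl, h.lastCoord]
  twoK := e.natReg_eq h.twoK
  zero := e.natReg_eq h.zero
  base := e.natReg_eq h.base
  scale := e.realReg_eq h.scale

theorem distProg_spec (hs : Constants n d k ε s) (p q : EuclideanSpace ℝ (Fin d)) {pa pb res : ℕ}
    (hp : ∀ j : Fin d, s.realMem (s.natReg pa + j) = p j)
    (hq : ∀ j : Fin d, s.realMem (s.natReg pb + j) = q j)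
    (hpa : pa < 40 := by norm_num) (hpb : pb < 40 := by norm_num) (hres : res < 40 := by norm_num) :
    HaltsIn (distProg pa pb res) s (distTime d) fun s' =>
      EqBelow 40 res s s' ∧ s'.realReg res = dist p q ^ 2 := by
  let I (i : ℕ) (s' : State) : Prop := EqBelow 40 res s s' ∧ s'.natReg coordReg = i ∧
    s'.natReg ptrReg₁ = s.natReg pa + i ∧ s'.natReg ptrReg₂ = s.natReg pb + i ∧ s'.realReg res =
      ∑ j ∈ Finset.range i, (s.realMem (s.natReg pa + j) - s.realMem (s.natReg pb + j)) ^ 2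
  have hinit : HaltsIn (block [.natConst coordReg 0, .natAdd ptrReg₁ pa zeroReg,
      .natAdd ptrReg₂ pb zeroReg, .realConst res 0]) s 5 (I 0) := HaltsIn.block
    ⟨EqBelow.runBlock (by simp) _, by simp, by simp [hs.zero, hpa.ne],
      by simp [hs.zero, hpb.ne, show pb ≠ 41 by omega], by simp⟩ (by simp)
  refine (hinit.seq fun s₀ hs₀ => HaltsIn.for (I := I) (N := d) (T := 9) ?_ ?_ hs₀).weaken ?_ ?_
  · rintro i - s' ⟨e, hi, -⟩
    have := hs.lastCoord
    simp only [Test.Holds, hi, e.natReg_eq (a := lastCoordReg) rfl]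
    omega
  · rintro i - s' ⟨e, hi, hpi, hqi, hsum⟩
    have hone : s'.natReg oneReg = 1 := e.natReg_eq hs.one
    refine HaltsIn.block ⟨e.trans (EqBelow.runBlock (by simp; omega) _), by simp [hi, hone],
      by simp [hpi, hone, add_assoc], by simp [hqi, hone, add_assoc], ?_⟩ (by simp)
    rw [Finset.sum_range_succ, ← hsum]
    simp [hpi, hqi, hres.ne, show res ≠ 41 by omega, e.realMem, sq]
  · simp only [distTime]
    omega
  · rintro s' ⟨e, -, -, -, hsum⟩
    refine ⟨e, ?_⟩
    rw [hsum, EuclideanSpace.dist_eq, Real.sq_sqrt (Finset.sum_nonneg fun _ _ => sq_nonneg _),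
      Finset.sum_range]
    exact Finset.sum_congr rfl fun j _ => by rw [hp, hq, Real.dist_eq, sq_abs]

theorem filter_val_lt_succ (U : Finset (Fin n)) (i : Fin n) :
    U.filter (fun j : Fin n => (j : ℕ) < i + 1) =
      if i ∈ U then insert i (U.filter fun j : Fin n => (j : ℕ) < i)
        else U.filter fun j : Fin n => (j : ℕ) < i := by
  have hsucc : ∀ j : Fin n, (j : ℕ) < i + 1 ↔ j = i ∨ (j : ℕ) < i := fun j => by
    rw [Fin.ext_iff]
    omega
  split_ifs with hi <;> ext j <;> simp only [Finset.mem_filter, Finset.mem_insert, hsucc]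
  · grind
  · grind

theorem visitUnflagged_spec {Q Q' : State → Prop} {i r T : ℕ} {body : Prog} (hr : 10 ≤ r)
    (hconst : ∀ s, Q s → Constants n d k ε s) (hconst' : ∀ s, Q' s → Constants n d k ε s)
    (hframe : ∀ s s', Q s → EqBelow r 40 s s' → Q s')
    (hframe' : ∀ s s', Q' s → EqBelow r 40 s s' → Q' s')
    (hbody : ∀ s, Q s → s.natMem i = 0 → s.natReg r = i → s.natReg (r + 1) = i * d →
      HaltsIn body s T fun s' => Q' s' ∧ s'.natReg r = i ∧ s'.natReg (r + 1) = i * d)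
    (hskip : ∀ s, Q s → s.natMem i ≠ 0 → Q' s) (hs : Q s) (hi : s.natReg r = i)
    (hid : s.natReg (r + 1) = i * d) :
    HaltsIn (visitUnflagged r body) s (T + 7) fun s' =>
      Q' s' ∧ s'.natReg r = i + 1 ∧ s'.natReg (r + 1) = (i + 1) * d := by
  have hload : HaltsIn (block [.natLoad (r + 2) r]) s 2 fun s' => Q s' ∧ s'.natReg r = i ∧
      s'.natReg (r + 1) = i * d ∧ s'.natReg (r + 2) = s'.natMem i := HaltsIn.block
    ⟨hframe _ _ hs (EqBelow.runBlock (by simp) _), by simp [hi], by simp [hid], by simp [hi]⟩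
    (by simp)
  refine (hload.seq (T' := T + 5) ?_).weaken (by omega) fun _ h => h
  rintro s₁ ⟨hs₁, hi, hid, hflag⟩
  have htest : (Test.natLe (r + 2) zeroReg).Holds s₁ ↔ s₁.natMem i = 0 := by
    rw [Test.Holds, hflag, (hconst _ hs₁).zero, Nat.le_zero]
  refine (HaltsIn.ite (T := T + 1) (Q := fun s' => Q' s' ∧ s'.natReg r = i ∧
    s'.natReg (r + 1) = i * d) (fun hc => ?_) fun hc => ?_).seq (T' := 3) ?_
  · exact (hbody s₁ hs₁ (htest.1 hc) hi hid).weaken (Nat.le_succ T) fun _ h => h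
  · exact HaltsIn.skip ⟨hskip s₁ hs₁ (mt htest.2 hc), hi, hid⟩ (by omega)
  · rintro s₂ ⟨hs₂, hi, hid⟩
    have hC := hconst' _ hs₂
    exact HaltsIn.block ⟨hframe' _ _ hs₂ (EqBelow.runBlock (by simp) _),
      by simp [hi, hC.one, show 3 ≠ r + 1 by omega], by simp [hid, hC.dim, add_mul]⟩ (by simp)

/-- If the points with flag `0` are those of `U`, then `forUnflagged` runs through `U`. The set in
the invariant is the part of `U` that has been treated; the body may change the flags there. -/
theorem forUnflagged_spec {U : Finset (Fin n)} (J : Finset (Fin n) → State → Prop) {r T : ℕ}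
    {body : Prog} (hr : 10 ≤ r) (hconst : ∀ S s, J S s → Constants n d k ε s)
    (hflag : ∀ S s, J S s → ∀ i : Fin n, i ∉ S → (s.natMem i = 0 ↔ i ∈ U))
    (hframe : ∀ S s s', J S s → EqBelow r 40 s s' → J S s')
    (hbody : ∀ S i, i ∈ U → i ∉ S → ∀ s, J S s → s.natReg r = i → s.natReg (r + 1) = i * d →
      HaltsIn body s T fun s' => J (insert i S) s' ∧ s'.natReg r = i ∧ s'.natReg (r + 1) = i * d)
    (hs : J ∅ s) : HaltsIn (forUnflagged r body) s (loopTime n T) (J U) := by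
  let S (t : ℕ) : Finset (Fin n) := U.filter fun i : Fin n => (i : ℕ) < t
  let I (t : ℕ) (s : State) : Prop := J (S t) s ∧ s.natReg r = t ∧ s.natReg (r + 1) = t * d
  have hinit : HaltsIn (block [.natConst r 0, .natConst (r + 1) 0]) s 3 (I 0) := HaltsIn.block
    ⟨hframe _ s _ (by simpa [S] using hs) (EqBelow.runBlock (by simp) _), by simp, by simp⟩
    (by simp)
  refine (hinit.seq fun s₀ hs₀ => HaltsIn.for (I := I) (N := n) (T := T + 7) ?_ ?_ hs₀).weaken ?_
    fun s' h' => by simpa [S] using h'.1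
  · rintro t - s' ⟨hJ, ht, -⟩
    have := (hconst _ _ hJ).last
    simp only [Test.Holds, ht]
    omega
  · rintro t ht s' ⟨hJ, hi, hid⟩
    let i : Fin n := ⟨t, ht⟩
    have hiS : i ∉ S t := by simp [S, i]
    have hin (hiU : i ∈ U) : S (t + 1) = insert i (S t) := by
      simpa only [if_pos hiU] using filter_val_lt_succ U i
    have hout (hiU : i ∉ U) : S (t + 1) = S t := by
      simpa only [if_neg hiU] using filter_val_lt_succ U i
    refine visitUnflagged_spec hr (hconst (S t)) (hconst (S (t + 1))) (hframe (S t))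
      (hframe (S (t + 1))) (fun s hJ h0 hi hid => ?_) (fun s hJ h0 => ?_) hJ hi hid
    · have hiU := (hflag _ _ hJ i hiS).1 h0
      exact hin hiU ▸ hbody _ i hiU hiS s hJ hi hid
    · exact (hout (mt (hflag _ _ hJ i hiS).2 h0)).symm ▸ hJ
  · simp only [loopTime]
    ring_nf
    omega

end Loops

/-! ### The peeling phase -/

open OrderedMedian

local notation "cardReg" => 9
local notation "foundReg" => 10
local notation "bestAddrReg" => 11
local notation "outerIdxReg" => 12
local notation "outerAddrReg" => 13
local notation "tmpReg" => 14
local notation "innerIdxReg" => 15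
local notation "innerAddrReg" => 16
local notation "countReg" => 18
local notation "countIdxReg" => 19
local notation "countAddrReg" => 20
local notation "bestSqReg" => 2
local notation "sqReg" => 3
local notation "distReg" => 4

/-- Puts `2 k` times the number of unflagged points whose squared distance from the current outer
point is at most the content of `sqReg` into `countReg`. -/
def countProg : Prog :=
  .seq (block [.natConst countReg 0])
    (forUnflagged countIdxReg
      (.seq (distProg outerAddrReg countAddrReg distReg)
        (.ite (.realLe distReg sqReg) (block [.natAdd countReg countReg twoKReg]) (.instr .skip))))

/-- Records the ball around the outer point with squared radius in `sqReg` as the best one. -/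
def recordProg : Prog :=
  block [.natConst foundReg 1, .natAdd bestAddrReg outerAddrReg zeroReg, .realConst bestSqReg 0,
    .realAdd bestSqReg bestSqReg sqReg]

/-- Examines the ball around the outer point through the inner point. -/
def examineProg : Prog :=
  .seq (.seq (distProg outerAddrReg innerAddrReg sqReg) countProg)
    (.ite (.natLe cardReg countReg)
      (.ite (.natLe foundReg zeroReg) recordProg
        (.ite (.realLe bestSqReg sqReg) (.instr .skip) recordProg))
      (.instr .skip))

/-- Finds a smallest heavy ball. -/
def searchProg : Prog :=
  .seq (block [.natConst foundReg 0])
    (forUnflagged outerIdxReg (forUnflagged innerIdxReg examineProg))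

/-- Removes the ball that has been found. -/
def removeProg : Prog :=
  forUnflagged outerIdxReg
    (.seq (distProg bestAddrReg outerAddrReg sqReg)
      (.ite (.realLe sqReg bestSqReg)
        (block [.natStore outerIdxReg oneReg, .natAdd tmpReg baseReg outerIdxReg,
          .realStore tmpReg bestSqReg, .natSub cardReg cardReg oneReg])
        (.instr .skip)))

/-- Removes smallest heavy balls until no point is left. -/
def peelProg : Prog := .while (.natLe oneReg cardReg) (.seq searchProg removeProg)

section Time

variable {S : Type*} [Semiring S]

/-- The running time of `countProg`. -/
def countTime (n d : S) : S := 2 + loopTime n (distTime d + 3)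

/-- The running time of `examineProg`. -/
def examineTime (n d : S) : S := distTime d + countTime n d + 8

/-- The running time of one round of peeling. -/
def roundTime (n d : S) : S :=
  2 + loopTime n (loopTime n (examineTime n d)) + loopTime n (distTime d + 6)

/-- The running time of `peelProg`. -/
def peelTime (n d : S) : S := n * (roundTime n d + 1) + 1

end Time

/-- The contents of registers and memory during the peeling: the points, of which those outside `U`
are flagged, and behind the coordinates of the points a number `m i` for each of them. -/
structure PeelState {d n : ℕ} (x : Fin n → EuclideanSpace ℝ (Fin d)) (k : ℕ) (ε : ℝ)
    (U : Finset (Fin n)) (m : Fin n → ℝ) (s : State) : Prop extends Constants n d k ε s where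
  card : s.natReg cardReg = U.card
  pts : ∀ (i : Fin n) (j : Fin d), s.realMem (i * d + j) = x i j
  rad : ∀ i : Fin n, s.realMem (n * d + i) = m i
  flag : ∀ i : Fin n, s.natMem i = if i ∈ U then 0 else 1

/-- Among the balls given by the pairs in `V`, the registers hold a smallest heavy one, if there is
any. -/
def HoldsBest {d n : ℕ} (x : Fin n → EuclideanSpace ℝ (Fin d)) (k : ℕ) (U : Finset (Fin n))
    (V : Finset (Fin n × Fin n)) (s : State) : Prop :=
  (s.natReg foundReg = 0 ∧ ∀ p ∈ V, ¬ Heavy x k U p.1 p.2) ∨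
    (s.natReg foundReg = 1 ∧ ∃ a b : Fin n, Heavy x k U a b ∧ s.natReg bestAddrReg = a * d ∧
      s.realReg bestSqReg = sqDist x a b ∧
      ∀ p ∈ V, Heavy x k U p.1 p.2 → sqDist x a b ≤ sqDist x p.1 p.2)

section Peel

variable {d n : ℕ} {x : Fin n → EuclideanSpace ℝ (Fin d)} {k : ℕ} {ε : ℝ} {U : Finset (Fin n)}
  {m : Fin n → ℝ} {V : Finset (Fin n × Fin n)} {a b : Fin n} {s s' : State}

theorem mul_add_lt_mul (i : Fin n) (j : Fin d) : (i : ℕ) * d + j < n * d :=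
  calc (i : ℕ) * d + j < i * d + d := by omega
    _ = (i + 1) * d := by ring
    _ ≤ n * d := Nat.mul_le_mul_right d i.2

theorem ballIn_insert (x : Fin n → EuclideanSpace ℝ (Fin d)) (S : Finset (Fin n)) (a b i : Fin n) :
    ballIn x (insert i S) a b =
      if sqDist x a i ≤ sqDist x a b then insert i (ballIn x S a b) else ballIn x S a b :=
  Finset.filter_insert _ _ _

theorem PeelState.congr (h : PeelState x k ε U m s) (e : EqBelow 10 2 s s') :
    PeelState x k ε U m s' where
  toConstants := h.toConstants.congr e.toRegsEq.mono
  card := e.natReg_eq h.card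
  pts := by rw [e.realMem]; exact h.pts
  rad := by rw [e.realMem]; exact h.rad
  flag := by rw [e.natMem]; exact h.flag

theorem PeelState.flag_eq_zero_iff (h : PeelState x k ε U m s) (i : Fin n) :
    s.natMem i = 0 ↔ i ∈ U := by
  simp [h.flag]

theorem PeelState.distProg_spec (h : PeelState x k ε U m s) {pa pb res : ℕ}
    (ha : s.natReg pa = a * d) (hb : s.natReg pb = b * d) (hpa : pa < 40 := by norm_num)
    (hpb : pb < 40 := by norm_num) (hres : res < 40 := by norm_num) :
    HaltsIn (distProg pa pb res) s (distTime d) fun s' =>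
      EqBelow 40 res s s' ∧ s'.realReg res = sqDist x a b :=
  RealRAM.distProg_spec h.toConstants (x a) (x b) (fun j => by rw [ha, h.pts])
    (fun j => by rw [hb, h.pts]) hpa hpb hres

theorem countProg_spec (h : PeelState x k ε U m s) (ha : s.natReg outerAddrReg = a * d)
    (hg : s.realReg sqReg = sqDist x a b) :
    HaltsIn countProg s (countTime n d) fun s' =>
      EqBelow 18 4 s s' ∧ s'.natReg countReg = 2 * k * (ballIn x U a b).card := by
  let J (S : Finset (Fin n)) (s' : State) : Prop :=
    EqBelow 18 4 s s' ∧ s'.natReg countReg = 2 * k * (ballIn x S a b).card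
  have hJ {S s'} (hs' : J S s') : PeelState x k ε U m s' := h.congr hs'.1.mono
  refine (HaltsIn.block (T := 2) (Q := J ∅) ⟨EqBelow.runBlock (by simp) _, by simp [ballIn]⟩
    (by simp)).seq fun s₀ hs₀ => forUnflagged_spec J (by norm_num)
    (fun S s' hs' => (hJ hs').toConstants) (fun S s' hs' i _ => (hJ hs').flag_eq_zero_iff i)
    (fun S s₁ s₂ hs₁ e => ⟨hs₁.1.trans e.mono, e.natReg_eq hs₁.2⟩)
    (fun S i _ hiS s₁ hs₁ hi hid => ?_) hs₀
  refine HaltsIn.seq (T' := 3) ((hJ hs₁).distProg_spec (hs₁.1.natReg_eq ha) hid) ?_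
  rintro s₂ ⟨e, hd⟩
  have he : EqBelow 18 4 s s₂ := hs₁.1.trans e.mono
  have hcount : s₂.natReg countReg = _ := e.natReg_eq hs₁.2
  have htest : (Test.realLe distReg sqReg).Holds s₂ ↔ sqDist x a i ≤ sqDist x a b := by
    rw [Test.Holds, hd, he.realReg_eq hg]
  refine HaltsIn.ite (fun hc => ?_) fun hc => ?_
  · refine HaltsIn.block ⟨⟨he.trans (EqBelow.runBlock (by simp) _), ?_⟩,
      by simp [e.natReg_eq hi], by simp [e.natReg_eq hid]⟩ (by simp)
    rw [ballIn_insert, if_pos (htest.1 hc),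
      Finset.card_insert_of_notMem fun hmem => hiS (ballIn_subset x S a b hmem)]
    simp [hcount, (h.congr he.mono).twoK, mul_add]
  · refine HaltsIn.skip ⟨⟨he, ?_⟩, e.natReg_eq hi, e.natReg_eq hid⟩ (by norm_num)
    rw [ballIn_insert, if_neg (mt htest.2 hc), hcount]

theorem HoldsBest.congr (h : HoldsBest x k U V s) (e : RegsEq 12 3 s s') :
    HoldsBest x k U V s' := by
  unfold HoldsBest
  rw [e.nat foundReg (by norm_num), e.nat bestAddrReg (by norm_num), e.real bestSqReg (by norm_num)]
  exact h

theorem HoldsBest.insert_of_not_heavy (h : HoldsBest x k U V s) (hab : ¬ Heavy x k U a b) :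
    HoldsBest x k U (insert (a, b) V) s := by
  simpa [HoldsBest, hab] using h

theorem HoldsBest.insert_of_le (h : HoldsBest x k U V s) (hfound : s.natReg foundReg ≠ 0)
    (hle : s.realReg bestSqReg ≤ sqDist x a b) : HoldsBest x k U (insert (a, b) V) s := by
  obtain ⟨hfound, a₀, b₀, h₀, haddr, hsq, hmin⟩ := h.resolve_left fun h => hfound h.1
  refine Or.inr ⟨hfound, a₀, b₀, h₀, haddr, hsq, fun p hp hheavy => ?_⟩
  rcases Finset.mem_insert.1 hp with rfl | hp
  · exact hsq ▸ hle
  · exact hmin p hp hheavy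

theorem HoldsBest.record (h : HoldsBest x k U V s) (hab : Heavy x k U a b)
    (hbetter : s.natReg foundReg = 0 ∨ sqDist x a b ≤ s.realReg bestSqReg)
    (hfound : s'.natReg foundReg = 1) (haddr : s'.natReg bestAddrReg = a * d)
    (hsq : s'.realReg bestSqReg = sqDist x a b) : HoldsBest x k U (insert (a, b) V) s' := by
  refine Or.inr ⟨hfound, a, b, hab, haddr, hsq, fun p hp hheavy => ?_⟩
  rcases Finset.mem_insert.1 hp with rfl | hp
  · exact le_rfl
  · rcases h with ⟨-, hnone⟩ | ⟨hfound', a₀, b₀, -, -, hsq', hmin⟩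
    · exact absurd hheavy (hnone p hp)
    · exact (hbetter.resolve_left (by omega)).trans (hsq' ▸ hmin p hp hheavy)

/-- What `examineProg` leaves unchanged: all but the scratch registers, `foundReg`, `bestAddrReg`
and `bestSqReg`. -/
structure ExamineFrame (s s' : State) : Prop where
  eqBelow : EqBelow 10 2 s s'
  loopReg : ∀ r, 12 ≤ r → r < 18 → s'.natReg r = s.natReg r

theorem ExamineFrame.trans {s'' : State} (h : ExamineFrame s s') (h' : ExamineFrame s' s'') :
    ExamineFrame s s'' :=
  ⟨h.eqBelow.trans h'.eqBelow, fun r hr hr' => (h'.loopReg r hr hr').trans (h.loopReg r hr hr')⟩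

theorem recordProg_spec (hs : Constants n d k ε s) (ha : s.natReg outerAddrReg = a * d)
    (hg : s.realReg sqReg = sqDist x a b) (hB : HoldsBest x k U V s) (hab : Heavy x k U a b)
    (hbetter : s.natReg foundReg = 0 ∨ sqDist x a b ≤ s.realReg bestSqReg) {T : ℕ} (hT : 5 ≤ T) :
    HaltsIn recordProg s T fun s' =>
      ExamineFrame s s' ∧ HoldsBest x k U (insert (a, b) V) s' := by
  refine HaltsIn.block ⟨⟨EqBelow.runBlock (by simp) _, fun r hr hr' => ?_⟩,
    hB.record hab hbetter ?_ ?_ ?_⟩ (by simpa using hT)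
  · simp [show r ≠ 11 by omega, show r ≠ 10 by omega]
  · simp
  · simp [ha, hs.zero]
  · simp [hg]

theorem examineProg_spec (h : PeelState x k ε U m s) (haU : a ∈ U) (hbU : b ∈ U)
    (ha : s.natReg outerAddrReg = a * d) (hb : s.natReg innerAddrReg = b * d)
    (hB : HoldsBest x k U V s) :
    HaltsIn examineProg s (examineTime n d) fun s' =>
      ExamineFrame s s' ∧ HoldsBest x k U (insert (a, b) V) s' := by
  have hmeasure : HaltsIn (.seq (distProg outerAddrReg innerAddrReg sqReg) countProg) s
      (distTime d + countTime n d) fun s' => EqBelow 18 3 s s' ∧ s'.realReg sqReg = sqDist x a b ∧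
        s'.natReg countReg = 2 * k * (ballIn x U a b).card := by
    refine (h.distProg_spec (res := sqReg) ha hb).seq ?_
    rintro s₁ ⟨e₁, hg⟩
    refine (countProg_spec (h.congr e₁.mono) (e₁.natReg_eq ha) hg).weaken le_rfl ?_
    rintro s₂ ⟨e₂, hcount⟩
    exact ⟨e₁.mono.trans e₂.mono, e₂.realReg_eq hg, hcount⟩
  refine hmeasure.seq (T' := 8) ?_
  rintro s₂ ⟨e, hg, hcount⟩
  have h₂ := h.congr e.mono
  have hB₂ := hB.congr e.toRegsEq.mono
  have hframe : ExamineFrame s s₂ := ⟨e.mono, fun r _ hr => e.nat r hr⟩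
  have hrecord (hab hbetter) {T : ℕ} (hT : 5 ≤ T) := (recordProg_spec h₂.toConstants
    (e.natReg_eq ha) hg hB₂ hab hbetter hT).weaken le_rfl fun _ => And.imp_left hframe.trans
  have hheavy : (Test.natLe cardReg countReg).Holds s₂ ↔ Heavy x k U a b := by
    rw [Test.Holds, h₂.card, hcount, Heavy, and_iff_right haU, and_iff_right hbU]
  have hfound : (Test.natLe foundReg zeroReg).Holds s₂ ↔ s₂.natReg foundReg = 0 := by
    rw [Test.Holds, h₂.zero, Nat.le_zero]
  have hle : (Test.realLe bestSqReg sqReg).Holds s₂ ↔ s₂.realReg bestSqReg ≤ sqDist x a b := by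
    rw [Test.Holds, hg]
  refine HaltsIn.ite (fun hab => ?_) fun hab => ?_
  · refine HaltsIn.ite (fun h0 => ?_) fun h0 => HaltsIn.ite (T := 5) (fun hc => ?_) fun hc => ?_
    · exact hrecord (hheavy.1 hab) (Or.inl (hfound.1 h0)) (by norm_num)
    · exact HaltsIn.skip ⟨hframe, hB₂.insert_of_le (mt hfound.2 h0) (hle.1 hc)⟩ (by norm_num)
    · exact hrecord (hheavy.1 hab) (Or.inr (not_le.1 (mt hle.2 hc)).le) le_rfl
  · exact HaltsIn.skip ⟨hframe, hB₂.insert_of_not_heavy (mt hheavy.2 hab)⟩ (by norm_num)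

theorem searchRow_spec (h : PeelState x k ε U m s) (haU : a ∈ U) (hidx : s.natReg outerIdxReg = a)
    (haddr : s.natReg outerAddrReg = a * d) (hB : HoldsBest x k U V s) :
    HaltsIn (forUnflagged innerIdxReg examineProg) s (loopTime n (examineTime n d)) fun s' =>
      EqBelow 10 2 s s' ∧ s'.natReg outerIdxReg = a ∧ s'.natReg outerAddrReg = a * d ∧
        HoldsBest x k U (V ∪ {a} ×ˢ U) s' := by
  let J (S : Finset (Fin n)) (s' : State) : Prop := EqBelow 10 2 s s' ∧
    s'.natReg outerIdxReg = a ∧ s'.natReg outerAddrReg = a * d ∧ HoldsBest x k U (V ∪ {a} ×ˢ S) s'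
  have hJ {S s'} (hs' : J S s') : PeelState x k ε U m s' := h.congr hs'.1
  refine forUnflagged_spec J (by norm_num) (fun S s' hs' => (hJ hs').toConstants)
    (fun S s' hs' i _ => (hJ hs').flag_eq_zero_iff i)
    (fun S s₁ s₂ h₁ e => ⟨h₁.1.trans e.mono, e.natReg_eq h₁.2.1, e.natReg_eq h₁.2.2.1,
      h₁.2.2.2.congr e.toRegsEq.mono⟩)
    (fun S b hbU _ s₁ hs₁ hidx' haddr' => ?_) ⟨EqBelow.rfl, hidx, haddr, by simpa using hB⟩
  obtain ⟨e, hidx, haddr, hB⟩ := hs₁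
  refine (examineProg_spec (h.congr e) haU hbU haddr haddr' hB).weaken le_rfl ?_
  rintro s₂ ⟨hF, hB⟩
  have hreg {r v : ℕ} (hv : s₁.natReg r = v) (hr : 12 ≤ r := by norm_num)
      (hr' : r < 18 := by norm_num) : s₂.natReg r = v := (hF.loopReg r hr hr').trans hv
  have hV : V ∪ {a} ×ˢ insert b S = insert (a, b) (V ∪ {a} ×ˢ S) := by
    ext ⟨a', b'⟩
    simp only [Finset.mem_union, Finset.mem_product, Finset.mem_insert, Finset.mem_singleton,
      Prod.mk.injEq]
    tauto
  exact ⟨⟨e.trans hF.eqBelow, hreg hidx, hreg haddr, hV ▸ hB⟩, hreg hidx', hreg haddr'⟩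

theorem searchProg_spec (hk : 1 ≤ k) (h : PeelState x k ε U m s) (hU : U.Nonempty) :
    HaltsIn searchProg s (2 + loopTime n (loopTime n (examineTime n d))) fun s' =>
      PeelState x k ε U m s' ∧ ∃ a b, IsLeastHeavy x k U a b ∧ s'.natReg bestAddrReg = a * d ∧
        s'.realReg bestSqReg = sqDist x a b := by
  let J (S : Finset (Fin n)) (s' : State) : Prop :=
    PeelState x k ε U m s' ∧ HoldsBest x k U (S ×ˢ U) s'
  suffices hloop : HaltsIn searchProg s (2 + loopTime n (loopTime n (examineTime n d))) (J U) by
    refine hloop.weaken le_rfl ?_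
    rintro s' ⟨h', ⟨-, hnone⟩ | ⟨-, a, b, hab, haddr, hsq, hmin⟩⟩
    · obtain ⟨a, b, hab⟩ := exists_heavy x hk hU
      exact absurd hab (hnone (a, b) (Finset.mk_mem_product hab.1 hab.2.1))
    · exact ⟨h', a, b, ⟨hab, fun a' b' h => hmin (a', b') (Finset.mk_mem_product h.1 h.2.1) h⟩,
        haddr, hsq⟩
  refine (HaltsIn.block (T := 2) (Q := J ∅)
    ⟨h.congr (EqBelow.runBlock (by simp) _), Or.inl ⟨by simp, by simp⟩⟩ (by simp)).seq
    fun s₀ h₀ => forUnflagged_spec J (by norm_num) (fun S s' hs' => hs'.1.toConstants)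
      (fun S s' hs' i _ => hs'.1.flag_eq_zero_iff i)
      (fun S s₁ s₂ h₁ e => ⟨h₁.1.congr e.mono, h₁.2.congr e.toRegsEq.mono⟩)
      (fun S a ha _ s₁ h₁ hidx haddr => (searchRow_spec h₁.1 ha hidx haddr h₁.2).weaken le_rfl ?_)
      h₀
  rintro s₂ ⟨e, hidx, haddr, hB⟩
  refine ⟨⟨h₁.1.congr e, ?_⟩, hidx, haddr⟩
  rwa [Finset.insert_eq, Finset.union_comm, Finset.union_product]

theorem PeelState.remove (h : PeelState x k ε U m s) {i : Fin n} (hi : i ∈ U) {g : ℝ}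
    (hreg : RegsEq 9 2 s s') (hcard : s'.natReg cardReg = s.natReg cardReg - 1)
    (hnat : s'.natMem = Function.update s.natMem i 1)
    (hreal : s'.realMem = Function.update s.realMem (n * d + i) g) :
    PeelState x k ε (U.erase i) (Function.update m i g) s' where
  toConstants := h.toConstants.congr hreg
  card := by rw [hcard, h.card, Finset.card_erase_of_mem hi]
  pts j l := by
    rw [hreal, Function.update_of_ne (by have := mul_add_lt_mul j l; omega), h.pts]
  rad j := by simp [hreal, h.rad, Fin.ext_iff]
  flag j := by
    rcases eq_or_ne j i with rfl | hj
    · simp [hnat]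
    · simp [hnat, h.flag, Fin.val_ne_of_ne hj, hj]

theorem removeProg_spec (h : PeelState x k ε U m s) (ha : s.natReg bestAddrReg = a * d)
    (hg : s.realReg bestSqReg = sqDist x a b) :
    HaltsIn removeProg s (loopTime n (distTime d + 6))
      (PeelState x k ε (U \ ballIn x U a b)
        ((ballIn x U a b).piecewise (fun _ => sqDist x a b) m)) := by
  let J (S : Finset (Fin n)) (s' : State) : Prop := PeelState x k ε (U \ ballIn x S a b)
    ((ballIn x S a b).piecewise (fun _ => sqDist x a b) m) s' ∧
      s'.natReg bestAddrReg = a * d ∧ s'.realReg bestSqReg = sqDist x a b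
  have hinit : J ∅ s := by
    refine ⟨?_, ha, hg⟩
    convert h using 1
    · simp [ballIn]
    · ext i
      simp [ballIn]
  refine (forUnflagged_spec J (by norm_num) (fun S s' hs' => hs'.1.toConstants) ?_
    (fun S s₁ s₂ h₁ e => ⟨h₁.1.congr e.mono, e.natReg_eq h₁.2.1, e.realReg_eq h₁.2.2⟩) ?_
    hinit).weaken le_rfl fun s' h' => h'.1
  · rintro S s' ⟨h', -⟩ i hi
    rw [h'.flag_eq_zero_iff, Finset.mem_sdiff,
      and_iff_left fun hiB => hi (ballIn_subset x S a b hiB)]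
  rintro S i hiU hiS s₁ ⟨h₁, haddr, hsq⟩ hidx hid
  have hiB : i ∉ ballIn x S a b := fun hiB => hiS (ballIn_subset x S a b hiB)
  refine HaltsIn.seq (T' := 6) (h₁.distProg_spec (res := sqReg) haddr hid) ?_
  rintro s₂ ⟨e, hd⟩
  have h₂ := h₁.congr e.mono
  have hidx₂ : s₂.natReg outerIdxReg = i := e.natReg_eq hidx
  have hsq₂ : s₂.realReg bestSqReg = sqDist x a b := e.realReg_eq hsq
  have htest : (Test.realLe sqReg bestSqReg).Holds s₂ ↔ sqDist x a i ≤ sqDist x a b := by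
    rw [Test.Holds, hd, hsq₂]
  refine HaltsIn.ite (fun hc => ?_) fun hc => ?_
  · simp only [J]
    rw [ballIn_insert, if_pos (htest.1 hc), Finset.sdiff_insert, Finset.piecewise_insert]
    refine HaltsIn.block ⟨⟨h₂.remove (Finset.mem_sdiff.2 ⟨hiU, hiB⟩)
      (RegsEq.runBlock (by simp) _) ?_ ?_ ?_, ?_, ?_⟩, ?_, ?_⟩ (by simp)
    all_goals simp [h₂.one, h₂.base, hidx₂, hsq₂, e.natReg_eq haddr, e.natReg_eq hid]
  · simp only [J]
    rw [ballIn_insert, if_neg (mt htest.2 hc)]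
    exact HaltsIn.skip ⟨⟨h₂, e.natReg_eq haddr, hsq₂⟩, hidx₂, e.natReg_eq hid⟩ (by norm_num)

theorem peelProg_spec (hk : 1 ≤ k) {log : Fin n → PeelEntry (Fin n)}
    (h : PeelState x k ε Finset.univ (fun i => (log i).sqRadius) s) :
    HaltsIn peelProg s (peelTime n d) fun s' => ∃ N log', IsPeeling x k N ∅ log' ∧
      PeelState x k ε ∅ (fun i => (log' i).sqRadius) s' := by
  let I (c : ℕ) (s : State) : Prop := ∃ N U log, U.card = c ∧ IsPeeling x k N U log ∧
    PeelState x k ε U (fun i => (log i).sqRadius) s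
  refine (HaltsIn.while (I := I) (T := roundTime n d) ?_ ?_ n
    ⟨0, _, log, by simp, .start log, h⟩).weaken le_rfl ?_
  · rintro c s ⟨-, U, log, rfl, -, h⟩
    rw [Test.Holds, h.one, h.card, Nat.one_le_iff_ne_zero, Nat.pos_iff_ne_zero]
  · rintro c hc s ⟨N, U, log, rfl, hlog, h⟩
    refine (searchProg_spec hk h (Finset.card_pos.1 hc)).seq ?_
    rintro s₁ ⟨h₁, a, b, hab, haddr, hsq⟩
    refine (removeProg_spec h₁ haddr hsq).weaken le_rfl fun s₂ h₂ => ?_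
    refine ⟨_, ?_, N + 1, _, _, rfl, hlog.step hab, ?_⟩
    · exact card_sdiff_ballIn_lt x hab.1.1 b
    · convert h₂ using 1
      ext i
      by_cases hi : i ∈ ballIn x U a b <;> simp [hi]
  · rintro s' ⟨N, U, log, hU, hlog, h⟩
    obtain rfl := Finset.card_eq_zero.1 hU
    exact ⟨N, log, hlog, h⟩

end Peel

/-! ### The net -/

local notation "repsReg" => 10
local notation "destReg" => 11
local notation "repReg" => 15
local notation "repAddrReg" => 16
local notation "matchReg" => 17

/-- Looks for a representative close to the current point. -/
def matchProg : Prog :=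
  .seq (block [.natAdd tmpReg baseReg outerIdxReg, .realLoad sqReg tmpReg,
      .realMul sqReg scaleReg sqReg, .natConst repReg 1, .natConst repAddrReg 0,
      .natConst matchReg 0])
    (.while (.natLe repReg repsReg)
      (.seq (.seq (distProg outerAddrReg repAddrReg distReg)
          (.ite (.realLe distReg sqReg) (block [.natAdd matchReg repReg zeroReg]) (.instr .skip)))
        (block [.natAdd repReg repReg oneReg, .natAdd repAddrReg repAddrReg dimReg])))

/-- Copies the point at the address in `pa` to the address in `pb`. -/
def copyProg (pa pb : ℕ) : Prog :=
  .seq (block [.natConst coordReg 0, .natAdd ptrReg₁ pa zeroReg, .natAdd ptrReg₂ pb zeroReg])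
    (.while (.natLe coordReg lastCoordReg)
      (block [.realLoad coordValReg₁ ptrReg₁, .realStore ptrReg₂ coordValReg₁,
        .natAdd ptrReg₁ ptrReg₁ oneReg, .natAdd ptrReg₂ ptrReg₂ oneReg,
        .natAdd coordReg coordReg oneReg]))

/-- Makes the current point a representative. -/
def appendProg : Prog :=
  .seq (copyProg outerAddrReg destReg)
    (block [.natAdd repsReg repsReg oneReg, .natAdd destReg destReg dimReg,
      .natAdd outerIdxReg outerIdxReg oneReg, .natAdd outerAddrReg outerAddrReg dimReg])

/-- Assigns the current point to the representative that has been found. -/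
def joinProg : Prog :=
  block [.natSub matchReg matchReg oneReg, .natLoad tmpReg matchReg,
    .natAdd tmpReg tmpReg oneReg, .natStore matchReg tmpReg,
    .natAdd outerIdxReg outerIdxReg oneReg, .natAdd outerAddrReg outerAddrReg dimReg]

/-- Chooses the representatives and counts the points that are assigned to them. -/
def netProg : Prog :=
  .seq (block [.natConst repsReg 0, .natConst destReg 0, .natConst outerIdxReg 0,
      .natConst outerAddrReg 0])
    (.while (.natLe outerIdxReg lastReg)
      (.seq matchProg (.ite (.natLe matchReg zeroReg) appendProg joinProg)))

section Time

variable {S : Type*} [Semiring S]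

/-- The running time of `matchProg`. -/
def matchTime (n d : S) : S := n * (distTime d + 7) + 8

/-- The running time of `copyProg`. -/
def copyTime (d : S) : S := 7 * d + 5

/-- The running time of `netProg`. -/
def netTime (n d : S) : S := n * (matchTime n d + copyTime d + 7) + 6

end Time

/-- The contents of registers and memory while the net is built, when the first `t` points have been
treated. The `R` representatives overwrite an initial segment of these points, and the numbers of
points assigned to them overwrite the flags, all of which are `1` at the beginning. -/
structure NetState {d n : ℕ} (x : Fin n → EuclideanSpace ℝ (Fin d)) (k : ℕ) (ε : ℝ)
    (m : Fin n → ℝ) (t R : ℕ) (rep : ℕ → Fin n) (asg : Fin n → ℕ) (s : State) : Prop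
    extends Constants n d k ε s where
  reps : s.natReg repsReg = R
  dest : s.natReg destReg = R * d
  idx : s.natReg outerIdxReg = t
  addr : s.natReg outerAddrReg = t * d
  rep_pts : ∀ r < R, ∀ j : Fin d, s.realMem (r * d + j) = x (rep r) j
  pts : ∀ i : Fin n, t ≤ i → ∀ j : Fin d, s.realMem (i * d + j) = x i j
  rad : ∀ i : Fin n, s.realMem (n * d + i) = m i
  mult : ∀ r < R, s.natMem r = load asg t r
  flag : ∀ r, R ≤ r → r < n → s.natMem r = 1

section Net

variable {d n : ℕ} {x : Fin n → EuclideanSpace ℝ (Fin d)} {k : ℕ} {ε : ℝ} {m : Fin n → ℝ}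
  {t R : ℕ} {rep : ℕ → Fin n} {asg : Fin n → ℕ} {p : Fin n} {s s' : State}

theorem NetState.congr (h : NetState x k ε m t R rep asg s) (e : EqBelow 14 2 s s') :
    NetState x k ε m t R rep asg s' where
  toConstants := h.toConstants.congr e.toRegsEq.mono
  reps := e.natReg_eq h.reps
  dest := e.natReg_eq h.dest
  idx := e.natReg_eq h.idx
  addr := e.natReg_eq h.addr
  rep_pts := by rw [e.realMem]; exact h.rep_pts
  pts := by rw [e.realMem]; exact h.pts
  rad := by rw [e.realMem]; exact h.rad
  mult := by rw [e.natMem]; exact h.mult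
  flag := by rw [e.natMem]; exact h.flag

theorem matchStep_spec {ρ : Fin n → ℝ} {r : ℕ} (h : NetState x k ε m p R rep asg s) (hr : r < R)
    (hrep : s.natReg repReg = r + 1) (haddr : s.natReg repAddrReg = r * d)
    (hρ : s.realReg sqReg = ρ p) (hmatch : IsMatch x ρ rep p r (s.natReg matchReg)) :
    HaltsIn (.seq (distProg outerAddrReg repAddrReg distReg)
        (.ite (.realLe distReg sqReg) (block [.natAdd matchReg repReg zeroReg]) (.instr .skip)))
      s (distTime d + 3) fun s' =>
        EqBelow 17 4 s s' ∧ IsMatch x ρ rep p (r + 1) (s'.natReg matchReg) := by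
  refine HaltsIn.seq (T' := 3) (distProg_spec h.toConstants (x p) (x (rep r))
    (fun j => by rw [h.addr, h.pts p le_rfl]) (fun j => by rw [haddr, h.rep_pts r hr])) ?_
  rintro s₁ ⟨e, hd⟩
  have htest : (Test.realLe distReg sqReg).Holds s₁ ↔ sqDist x p (rep r) ≤ ρ p := by
    rw [Test.Holds, hd, e.realReg_eq hρ, sqDist]
  refine HaltsIn.ite (fun hc => ?_) fun hc => ?_
  · refine HaltsIn.block ⟨e.mono.trans (EqBelow.runBlock (by simp) _), ?_⟩ (by simp)
    simpa [e.natReg_eq hrep, e.natReg_eq h.zero] using isMatch_succ (htest.1 hc)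
  · refine HaltsIn.skip ⟨e.mono, ?_⟩ (by norm_num)
    rw [e.natReg_eq (a := matchReg) rfl]
    exact hmatch.succ (not_le.1 (mt htest.2 hc))

theorem matchProg_spec (h : NetState x k ε m p R rep asg s) (hR : R ≤ n) :
    HaltsIn matchProg s (matchTime n d) fun s' => EqBelow 14 3 s s' ∧
      IsMatch x (fun i => ε ^ 2 / 16 * m i) rep p R (s'.natReg matchReg) := by
  let I (r : ℕ) (s' : State) : Prop := EqBelow 14 3 s s' ∧ s'.natReg repReg = r + 1 ∧
    s'.natReg repAddrReg = r * d ∧ s'.realReg sqReg = ε ^ 2 / 16 * m p ∧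
    IsMatch x (fun i => ε ^ 2 / 16 * m i) rep p r (s'.natReg matchReg)
  have hinit : HaltsIn (block [.natAdd tmpReg baseReg outerIdxReg, .realLoad sqReg tmpReg,
      .realMul sqReg scaleReg sqReg, .natConst repReg 1, .natConst repAddrReg 0,
      .natConst matchReg 0]) s 7 (I 0) := HaltsIn.block
    ⟨EqBelow.runBlock (by simp) _, by simp, by simp, by simp [h.base, h.idx, h.rad, h.scale],
      Or.inl ⟨by simp, by simp⟩⟩ (by simp)
  refine (hinit.seq fun s₀ hs₀ => HaltsIn.for (I := I) (N := R) (T := distTime d + 3 + 3) ?_ ?_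
    hs₀).weaken ?_ fun s' h' => ⟨h'.1, h'.2.2.2.2⟩
  · rintro r - s' ⟨e, hrep, -⟩
    rw [Test.Holds, hrep, (h.congr e.mono).reps, Nat.succ_le_iff]
  · rintro r hr s₁ ⟨e₁, hrep, haddr, hρ, hmatch⟩
    refine (matchStep_spec (h.congr e₁.mono) hr hrep haddr hρ hmatch).seq ?_
    rintro s₂ ⟨e₂, hmatch⟩
    have e : EqBelow 14 3 s s₂ := e₁.trans e₂.mono
    refine HaltsIn.block ⟨e.trans (EqBelow.runBlock (by simp) _), ?_, ?_, ?_, ?_⟩ (by simp)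
    · simp [e₂.natReg_eq hrep, (h.congr e.mono).one]
    · simp [e₂.natReg_eq haddr, (h.congr e.mono).dim, add_mul]
    · simp [e₂.realReg_eq hρ]
    · simpa using hmatch
  · have := Nat.mul_le_mul_right (distTime d + 3 + 3 + 1) hR
    simp only [matchTime]
    ring_nf at this ⊢
    omega

theorem copyProg_spec (hs : Constants n d k ε s) {pa pb : ℕ} (hle : s.natReg pb ≤ s.natReg pa)
    (hpa : pa < 40 := by norm_num) (hpb : pb < 40 := by norm_num) :
    HaltsIn (copyProg pa pb) s (copyTime d) fun s' => RegsEq 40 40 s s' ∧ s'.natMem = s.natMem ∧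
      s'.realMem = fun l => if s.natReg pb ≤ l ∧ l < s.natReg pb + d
        then s.realMem (s.natReg pa + (l - s.natReg pb)) else s.realMem l := by
  let I (i : ℕ) (s' : State) : Prop := RegsEq 40 40 s s' ∧ s'.natMem = s.natMem ∧
    s'.natReg coordReg = i ∧ s'.natReg ptrReg₁ = s.natReg pa + i ∧
    s'.natReg ptrReg₂ = s.natReg pb + i ∧
    s'.realMem = fun l => if s.natReg pb ≤ l ∧ l < s.natReg pb + i
      then s.realMem (s.natReg pa + (l - s.natReg pb)) else s.realMem l
  have hinit : HaltsIn (block [.natConst coordReg 0, .natAdd ptrReg₁ pa zeroReg,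
      .natAdd ptrReg₂ pb zeroReg]) s 4 (I 0) := HaltsIn.block
    ⟨RegsEq.runBlock (by simp) _, by simp, by simp, by simp [hs.zero, hpa.ne],
      by simp [hs.zero, hpb.ne, show pb ≠ 41 by omega], by ext l; simp⟩ (by simp)
  refine (hinit.seq fun s₀ hs₀ => HaltsIn.for (I := I) (N := d) (T := 6) ?_ ?_ hs₀).weaken ?_
    fun s' h' => ⟨h'.1, h'.2.1, h'.2.2.2.2.2⟩
  · rintro i - s' ⟨e, -, hi, -⟩
    have := hs.lastCoord
    simp only [Test.Holds, hi, e.natReg_eq (a := lastCoordReg) rfl]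
    omega
  · rintro i - s' ⟨e, hmem, hi, hpi, hqi, hcopy⟩
    have hone : s'.natReg oneReg = 1 := e.natReg_eq hs.one
    refine HaltsIn.block ⟨e.trans (RegsEq.runBlock (by simp) _), by simpa using hmem,
      by simp [hi, hone], by simp [hpi, hone, add_assoc], by simp [hqi, hone, add_assoc], ?_⟩
      (by simp)
    have hread : s'.realMem (s.natReg pa + i) = s.realMem (s.natReg pa + i) := by
      rw [hcopy]
      exact if_neg (by omega)
    ext l
    simp only [runBlock, List.foldl, Instr.run, hpi, hqi]
    grind
  · simp only [copyTime]
    omega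

theorem appendProg_spec {ρ : Fin n → ℝ} (hN : IsNet x ρ p R rep asg)
    (h : NetState x k ε m p R rep asg s) :
    HaltsIn appendProg s (copyTime d + 5)
      (NetState x k ε m (p + 1) (R + 1) (Function.update rep R p) (Function.update asg p R)) := by
  have hRp : R * d ≤ p * d := Nat.mul_le_mul_right d hN.le
  have hRn : (R + 1) * d ≤ n * d := Nat.mul_le_mul_right d (hN.le.trans_lt p.2)
  refine (copyProg_spec h.toConstants (pa := outerAddrReg) (pb := destReg)
    (by rw [h.dest, h.addr]; exact hRp)).seq (T' := 5) ?_
  rintro s₁ ⟨e, hnat, hreal⟩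
  rw [h.dest, h.addr] at hreal
  have h₁ : Constants n d k ε s₁ := h.toConstants.congr e.mono
  refine HaltsIn.block ⟨h₁.congr (RegsEq.runBlock (by simp) _), ?_, ?_, ?_, ?_, ?_, ?_, ?_, ?_, ?_⟩
    (by simp)
  · simp [e.natReg_eq h.reps, h₁.one]
  · simp [e.natReg_eq h.dest, h₁.dim, add_mul]
  · simp [e.natReg_eq h.idx, h₁.one]
  · simp [e.natReg_eq h.addr, h₁.dim, add_mul]
  · intro r hr j
    rcases Nat.lt_succ_iff_lt_or_eq.1 hr with hr | rfl
    · have := mul_add_lt_mul ⟨r, hr⟩ j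
      rw [Function.update_of_ne hr.ne, ← h.rep_pts r hr]
      simpa [hreal] using fun hle => absurd hle (by simpa using this)
    · simp [hreal, h.pts p le_rfl]
  · intro i hi j
    have : (R + 1) * d ≤ i * d := Nat.mul_le_mul_right d ((Nat.succ_le_succ hN.le).trans hi)
    rw [← h.pts i (p.1.le_succ.trans hi)]
    simpa [hreal] using fun _ => by grind
  · intro i
    rw [← h.rad i]
    simpa [hreal] using fun _ => by grind
  · intro r hr
    rcases Nat.lt_succ_iff_lt_or_eq.1 hr with hr | rfl
    · rw [load_update_of_ne asg p hr.ne, ← h.mult r hr]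
      simp [hnat]
    · rw [load_update_self, hN.load_eq_zero, ← h.flag r le_rfl (hN.le.trans_lt p.2)]
      simp [hnat]
  · intro r hr hrn
    rw [← h.flag r (Nat.le_of_succ_le hr) hrn]
    simp [hnat]

theorem joinProg_spec (h : NetState x k ε m p R rep asg s) {r : ℕ} (hr : r < R)
    (hmatch : s.natReg matchReg = r + 1) {T : ℕ} (hT : 7 ≤ T) :
    HaltsIn joinProg s T (NetState x k ε m (p + 1) R rep (Function.update asg p r)) := by
  refine HaltsIn.block ⟨h.toConstants.congr (RegsEq.runBlock (by simp) _), ?_, ?_, ?_, ?_, ?_, ?_,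
    ?_, fun r' hr' => ?_, fun r' hr' hrn => ?_⟩ (by simpa using hT)
  · simp [h.reps]
  · simp [h.dest]
  · simp [h.idx, h.one]
  · simp [h.addr, h.dim, add_mul]
  · exact h.rep_pts
  · exact fun i hi => h.pts i (p.1.le_succ.trans hi)
  · exact h.rad
  · rcases eq_or_ne r' r with rfl | hne
    · simp [load_update_self, hmatch, h.one, h.mult r' hr]
    · simp [load_update_of_ne asg p hne, hmatch, h.one, hne, h.mult r' hr']
  · simp [hmatch, h.one, (hr.trans_le hr').ne', h.flag r' hr' hrn]

theorem netStep_spec (hN : IsNet x (fun i => ε ^ 2 / 16 * m i) p R rep asg)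
    (h : NetState x k ε m p R rep asg s) (hm : 0 ≤ m p) :
    HaltsIn (.seq matchProg (.ite (.natLe matchReg zeroReg) appendProg joinProg)) s
      (matchTime n d + (copyTime d + 6)) fun s' => ∃ R' rep' asg',
        IsNet x (fun i => ε ^ 2 / 16 * m i) (p + 1) R' rep' asg' ∧
          NetState x k ε m (p + 1) R' rep' asg' s' := by
  refine (matchProg_spec h (hN.le.trans p.2.le)).seq ?_
  rintro s₁ ⟨e, hmatch⟩
  have h₁ := h.congr e.mono
  have htest : (Test.natLe matchReg zeroReg).Holds s₁ ↔ s₁.natReg matchReg = 0 := by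
    rw [Test.Holds, h₁.zero, Nat.le_zero]
  refine HaltsIn.ite (T := copyTime d + 5) (fun hc => ?_) fun hc => ?_
  · obtain ⟨-, hfar⟩ := hmatch.resolve_right fun ⟨r, _, hr, _⟩ => by simp [htest.1 hc] at hr
    exact (appendProg_spec hN h₁).weaken le_rfl fun s' h' =>
      ⟨_, _, _, hN.insert (by positivity) hfar, h'⟩
  · obtain ⟨r, hr, hreg, hnear⟩ := hmatch.resolve_left fun h => hc (htest.2 h.1)
    exact (joinProg_spec h₁ hr hreg (by simp only [copyTime]; omega)).weaken le_rfl fun s' h' =>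
      ⟨_, _, _, hN.join hr hnear, h'⟩

theorem netProg_spec (h : PeelState x k ε ∅ m s) (hm : ∀ i, 0 ≤ m i) :
    HaltsIn netProg s (netTime n d) fun s' => ∃ R rep asg,
      IsNet x (fun i => ε ^ 2 / 16 * m i) n R rep asg ∧ NetState x k ε m n R rep asg s' := by
  let I (t : ℕ) (s : State) : Prop := ∃ R rep asg,
    IsNet x (fun i => ε ^ 2 / 16 * m i) t R rep asg ∧ NetState x k ε m t R rep asg s
  have hn : 0 < n := h.last ▸ Nat.succ_pos _
  have hinit : HaltsIn (block [.natConst repsReg 0, .natConst destReg 0, .natConst outerIdxReg 0,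
      .natConst outerAddrReg 0]) s 5 (I 0) := by
    refine HaltsIn.block ⟨0, fun _ => ⟨0, hn⟩, 0, .empty .., ?_⟩ (by simp)
    exact ⟨h.toConstants.congr (RegsEq.runBlock (by simp) _), by simp, by simp, by simp, by simp,
      by simp, fun i _ => h.pts i, h.rad, by simp, fun r _ hr => by simpa using h.flag ⟨r, hr⟩⟩
  refine (hinit.seq fun s₀ h₀ => HaltsIn.for (I := I) (N := n)
    (T := matchTime n d + (copyTime d + 6)) ?_ ?_ h₀).weaken ?_ fun s' h' => h'
  · rintro t - s' ⟨R, rep, asg, -, h'⟩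
    rw [Test.Holds, h'.idx, ← h'.last, Nat.lt_succ_iff]
  · rintro t ht s' ⟨R, rep, asg, hN, h'⟩
    exact netStep_spec (p := ⟨t, ht⟩) hN h' (hm _)
  · simp only [netTime]
    ring_nf
    omega

end Net

/-! ### The complete program -/

/-- Multiplies the dimension by the number of points, by repeated addition. -/
def baseProg : Prog :=
  .while (.natLe outerIdxReg lastReg)
    (block [.natAdd baseReg baseReg dimReg, .natAdd outerIdxReg outerIdxReg oneReg])

/-- Sets up the constants. -/
def initProg : Prog :=
  .seq (block [.natConst oneReg 1, .natSub lastReg 0 oneReg, .natSub lastCoordReg dimReg oneReg,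
      .natAdd twoKReg 2 2, .natAdd cardReg 0 zeroReg, .realMul scaleReg 0 0, .realConst 2 16,
      .realDiv scaleReg scaleReg 2])
    baseProg

/-- Computes a simultaneous coreset. -/
def coresetProg : Prog :=
  .seq initProg (.seq peelProg (.seq netProg (block [.natAdd 0 repsReg zeroReg])))

section Time

variable {S : Type*} [Semiring S]

/-- The running time of `initProg`. -/
def initTime (n : S) : S := 9 + (n * 4 + 1)

/-- The running time of `coresetProg`. -/
def coresetTime (n d : S) : S := initTime n + (peelTime n d + (netTime n d + 2))

end Time

theorem coresetTime_mono {n d n' d' : ℕ} (hn : n ≤ n') (hd : d ≤ d') :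
    coresetTime n d ≤ coresetTime n' d' := by
  unfold coresetTime initTime peelTime roundTime examineTime countTime netTime matchTime copyTime
    loopTime distTime
  gcongr

theorem eval_coresetTime (N : ℕ) :
    (coresetTime (Polynomial.X : Polynomial ℕ) Polynomial.X).eval N = coresetTime N N := by
  simp [coresetTime, initTime, peelTime, roundTime, examineTime, countTime, netTime, matchTime,
    copyTime, loopTime, distTime]

section Coreset

variable {d n k : ℕ} {ε : ℝ} {x : Fin n → EuclideanSpace ℝ (Fin d)} {s : State}

theorem inputState_realMem (k : ℕ) (ε : ℝ) (x : Fin n → EuclideanSpace ℝ (Fin d)) (i : Fin n)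
    (j : Fin d) : (inputState k ε x).realMem (i * d + j) = x i j := by
  have he : (⟨i * d + j, mul_add_lt_mul i j⟩ : Fin (n * d)) = finProdFinEquiv (i, j) := by
    ext
    simp [finProdFinEquiv, add_comm, mul_comm]
  simp only [inputState, mul_add_lt_mul, dif_pos, he, Equiv.symm_apply_apply]

theorem baseProg_spec (hone : s.natReg oneReg = 1) (hlast : s.natReg lastReg + 1 = n)
    (hdim : s.natReg dimReg = d) (hidx : s.natReg outerIdxReg = 0) (hbase : s.natReg baseReg = 0) :
    HaltsIn baseProg s (n * 4 + 1) fun s' => EqBelow 8 2 s s' ∧ s'.natReg baseReg = n * d ∧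
      s'.natReg cardReg = s.natReg cardReg := by
  let I (t : ℕ) (s' : State) : Prop := EqBelow 8 2 s s' ∧ s'.natReg outerIdxReg = t ∧
    s'.natReg baseReg = t * d ∧ s'.natReg cardReg = s.natReg cardReg
  refine (HaltsIn.for (I := I) (N := n) (T := 3) ?_ ?_
    ⟨EqBelow.rfl, hidx, by rw [hbase, zero_mul], rfl⟩).weaken le_rfl fun s' h' => ⟨h'.1, h'.2.2⟩
  · rintro t - s' ⟨e, ht, -⟩
    rw [Test.Holds, ht, e.natReg_eq (a := lastReg) rfl]
    omega
  · rintro t - s' ⟨e, ht, hbase, hcard⟩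
    exact HaltsIn.block ⟨e.trans (EqBelow.runBlock (by simp) _), by simp [ht, e.natReg_eq hone],
      by simp [hbase, e.natReg_eq hdim, add_mul], by simpa using hcard⟩ (by simp)

theorem initProg_spec (k : ℕ) (ε : ℝ) (x : Fin n → EuclideanSpace ℝ (Fin d)) (hn : 1 ≤ n)
    (hd : 1 ≤ d) :
    HaltsIn initProg (inputState k ε x) (initTime n) (PeelState x k ε Finset.univ fun _ => 0) := by
  have hconst : HaltsIn (block [.natConst oneReg 1, .natSub lastReg 0 oneReg,
      .natSub lastCoordReg dimReg oneReg, .natAdd twoKReg 2 2, .natAdd cardReg 0 zeroReg,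
      .realMul scaleReg 0 0, .realConst 2 16, .realDiv scaleReg scaleReg 2]) (inputState k ε x) 9
      fun s => s.natReg dimReg = d ∧ s.natReg oneReg = 1 ∧ s.natReg lastReg + 1 = n ∧
        s.natReg lastCoordReg + 1 = d ∧ s.natReg twoKReg = 2 * k ∧ s.natReg zeroReg = 0 ∧
        s.realReg scaleReg = ε ^ 2 / 16 ∧ s.natReg cardReg = n ∧ s.natReg outerIdxReg = 0 ∧
        s.natReg baseReg = 0 ∧ s.natMem = (inputState k ε x).natMem ∧
        s.realMem = (inputState k ε x).realMem :=
    HaltsIn.block (by simp [inputState, two_mul, sq, hn, hd]) (by simp)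
  refine hconst.seq ?_
  rintro s ⟨hdim, hone, hlast, hlastCoord, htwoK, hzero, hscale, hcard, hidx, hbase, hnat, hreal⟩
  refine (baseProg_spec hone hlast hdim hidx hbase).weaken le_rfl ?_
  rintro s' ⟨e, hbase, hcard'⟩
  refine ⟨⟨e.natReg_eq hdim, e.natReg_eq hone, by rw [e.natReg_eq rfl, hlast],
    by rw [e.natReg_eq rfl, hlastCoord], e.natReg_eq htwoK, e.natReg_eq hzero, hbase,
    e.realReg_eq hscale⟩, by simp [hcard', hcard], fun i j => ?_, fun i => ?_, fun i => ?_⟩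
  · rw [e.realMem, hreal]
    exact inputState_realMem k ε x i j
  · simp [e.realMem, hreal, inputState]
  · simp [e.natMem, hnat, inputState]

/-- The multiset that arises from moving every point to its representative. -/
def netMultiset (x : Fin n → EuclideanSpace ℝ (Fin d)) (rep : ℕ → Fin n) (asg : Fin n → ℕ) :
    Multiset (EuclideanSpace ℝ (Fin d)) :=
  Finset.univ.val.map fun i => x (rep (asg i))

variable {ρ : Fin n → ℝ} {R r : ℕ} {rep : ℕ → Fin n} {asg : Fin n → ℕ}

theorem size_netMultiset (h : IsNet x ρ n R rep asg) (hρ : ∀ i, 0 ≤ ρ i) :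
    size (netMultiset x rep asg) = R := by
  classical
  have himage : (netMultiset x rep asg).toFinset = (Finset.range R).image fun r => x (rep r) := by
    ext p
    simp only [netMultiset, Multiset.mem_toFinset, Multiset.mem_map, Finset.mem_val,
      Finset.mem_univ, true_and, Finset.mem_image, Finset.mem_range]
    constructor
    · rintro ⟨i, rfl⟩
      exact ⟨asg i, h.asg_lt i i.2, rfl⟩
    · rintro ⟨r, hr, rfl⟩
      exact ⟨rep r, by rw [h.asg_rep r hr]⟩
  rw [← Finset.card_range R, ← Finset.card_image_of_injOn (h.injOn hρ), ← himage, size]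

open Classical in
theorem count_netMultiset (h : IsNet x ρ n R rep asg) (hρ : ∀ i, 0 ≤ ρ i) (hr : r < R) :
    (netMultiset x rep asg).count (x (rep r)) = load asg n r := by
  rw [netMultiset, Multiset.count_map, load, Finset.card_def, Finset.filter_val]
  refine congrArg _ (Multiset.filter_congr fun i _ => ?_)
  rw [and_iff_right i.2, (h.injOn hρ).eq_iff (by simpa using hr) (by simpa using h.asg_lt i i.2),
    eq_comm]

theorem represents_netMultiset (hN : IsNet x ρ n R rep asg) (hρ : ∀ i, 0 ≤ ρ i)
    (hreg : s.natReg 0 = R) (hmult : ∀ r < R, s.natMem r = load asg n r)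
    (hpts : ∀ r < R, ∀ j : Fin d, s.realMem (r * d + j) = x (rep r) j) :
    Represents s (netMultiset x rep asg) := by
  have hlt (i : Fin (size (netMultiset x rep asg))) : (i : ℕ) < R :=
    i.2.trans_eq (size_netMultiset hN hρ)
  refine ⟨by rw [hreg, size_netMultiset hN hρ], fun i => x (rep i), fun i i' he => ?_,
    fun i => ⟨?_, ?_, hpts i (hlt i)⟩⟩
  · exact Fin.ext (hN.injOn hρ (by simpa using hlt i) (by simpa using hlt i') he)
  · exact Multiset.mem_map.2 ⟨rep i, Finset.mem_univ_val _, by rw [hN.asg_rep i (hlt i)]⟩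
  · rw [hmult i (hlt i), count_netMultiset hN hρ (hlt i)]

theorem isSimultaneousCoreset_netMultiset {N : ℕ} {log : Fin n → PeelEntry (Fin n)} (hk : 1 ≤ k)
    (hε : 0 ≤ ε) (hlog : IsPeeling x k N ∅ log)
    (hN : IsNet x (fun i => ε ^ 2 / 16 * (log i).sqRadius) n R rep asg) :
    IsSimultaneousCoreset k ε (Finset.univ.val.map x) (netMultiset x rep asg) :=
  hlog.isSimultaneousCoreset hk hε fun i => hN.near i i.2

theorem size_netMultiset_le {N : ℕ} {log : Fin n → PeelEntry (Fin n)} (hn : 2 ≤ n) (hd : 1 ≤ d)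
    (hk : 1 ≤ k) (hε : 0 < ε) (hε1 : ε ≤ 1) (hlog : IsPeeling x k N ∅ log)
    (hN : IsNet x (fun i => ε ^ 2 / 16 * (log i).sqRadius) n R rep asg) :
    (size (netMultiset x rep asg) : ℝ) ≤ 36 ^ d * (k * Real.log n / ε ^ d) := by
  have hρ (i : Fin n) : 0 ≤ ε ^ 2 / 16 * (log i).sqRadius :=
    mul_nonneg (by positivity) (hlog.sqRadius_nonneg (Finset.notMem_empty i))
  have hinj : Set.InjOn rep (Finset.range R) := fun r hr r' hr' he =>
    hN.injOn hρ hr hr' (congrArg x he)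
  rw [size_netMultiset hN hρ, ← Finset.card_range R, ← Finset.card_image_of_injOn hinj]
  refine hlog.card_le_of_pairwise hn hd hk hε hε1 ?_
  rw [Finset.coe_image, hinj.pairwise_image]
  intro r hr r' hr' hne
  rw [Function.onFun, mul_min_of_nonneg _ _ (by positivity)]
  exact hN.sep r (Finset.mem_range.1 hr) r' (Finset.mem_range.1 hr') hne

theorem coresetProg_spec (hn : 1 ≤ n) (hd : 1 ≤ d) (hk : 1 ≤ k) (ε : ℝ)
    (x : Fin n → EuclideanSpace ℝ (Fin d)) :
    HaltsIn coresetProg (inputState k ε x) (coresetTime n d) fun s =>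
      ∃ N log R rep asg, IsPeeling x k N ∅ log ∧
        IsNet x (fun i => ε ^ 2 / 16 * (log i).sqRadius) n R rep asg ∧
          Represents s (netMultiset x rep asg) := by
  refine (initProg_spec k ε x hn hd).seq fun s₁ h₁ => ?_
  refine (peelProg_spec hk (log := fun i => ⟨0, 0, i, 0⟩) h₁).seq ?_
  rintro s₂ ⟨N, log, hlog, h₂⟩
  have hnonneg (i : Fin n) : 0 ≤ (log i).sqRadius :=
    hlog.sqRadius_nonneg (Finset.notMem_empty i)
  refine (netProg_spec h₂ hnonneg).seq ?_
  rintro s₃ ⟨R, rep, asg, hN, h₃⟩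
  refine HaltsIn.block ⟨N, log, R, rep, asg, hlog, hN, ?_⟩ (by simp)
  exact represents_netMultiset hN (fun i => mul_nonneg (by positivity) (hnonneg i))
    (by simp [h₃.reps, h₃.zero]) h₃.mult h₃.rep_pts

end Coreset

end RealRAM

end

theorem one_le_dim_of_injective {d n : ℕ} {x : Fin n → EuclideanSpace ℝ (Fin d)} (hn : 2 ≤ n)
    (hx : Function.Injective x) : 1 ≤ d := by
  have : Nontrivial (Fin n) := Fin.nontrivial_iff_two_le.2 hn
  by_contra! hd
  obtain rfl := Nat.lt_one_iff.1 hd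
  exact not_subsingleton (Fin n) hx.subsingleton

theorem mul_log_le_two_mul_sq_mul_log_sq {k n : ℕ} (hk : 1 ≤ k) (hn : 2 ≤ n) :
    k * Real.log n ≤ 2 * ((k : ℝ) ^ 2 * Real.log n ^ 2) := by
  have hlog := OrderedMedian.half_le_log hn
  have hk' : (1 : ℝ) ≤ k := by exact_mod_cast hk
  have : 1 / 2 ≤ k * Real.log n := by nlinarith
  nlinarith

theorem pow_mul_le_two_mul_pow_mul {a b c : ℝ} {d : ℕ} (hc : 0 ≤ c) (hb : 0 ≤ b) (hd : 1 ≤ d)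
    (hab : a ≤ 2 * b) : c ^ d * a ≤ (2 * c) ^ d * b :=
  calc c ^ d * a ≤ c ^ d * (2 * b) := by gcongr
    _ = c ^ d * (2 ^ 1 * b) := by rw [pow_one]
    _ ≤ c ^ d * (2 ^ d * b) := by gcongr; norm_num
    _ = (2 * c) ^ d * b := by rw [mul_pow]; ring

theorem theorem4p5_general :
    ∃ (prog : RealRAM.Prog) (P : Polynomial ℕ),
      ∀ (d n k : ℕ) (ε : ℝ) (x : Fin n → EuclideanSpace ℝ (Fin d)),
        1 ≤ d → 2 ≤ n → 1 ≤ k → 0 < ε → ε ≤ 1 →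
        ∃ D : Multiset (EuclideanSpace ℝ (Fin d)),
          OrderedMedian.IsSimultaneousCoreset k ε (Finset.univ.val.map x) D ∧
          (OrderedMedian.size D : ℝ) ≤ 36 ^ d * (k * Real.log n / ε ^ d) ∧
          ∃ (t : ℕ) (s : RealRAM.State),
            RealRAM.Exec prog (RealRAM.inputState k ε x) t s ∧
            t ≤ P.eval (n * d) ∧ RealRAM.Represents s D := by
  refine ⟨RealRAM.coresetProg, RealRAM.coresetTime Polynomial.X Polynomial.X, ?_⟩
  intro d n k ε x hd hn hk hε hε1
  have hn1 : 1 ≤ n := one_le_two.trans hn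
  obtain ⟨t, s, hexec, ht, N, log, R, rep, asg, hlog, hN, hrep⟩ :=
    RealRAM.coresetProg_spec hn1 hd hk ε x
  refine ⟨_, RealRAM.isSimultaneousCoreset_netMultiset hk hε.le hlog hN,
    RealRAM.size_netMultiset_le hn hd hk hε hε1 hlog hN, t, s, hexec, ht.trans ?_, hrep⟩
  rw [RealRAM.eval_coresetTime]
  exact RealRAM.coresetTime_mono (Nat.le_mul_of_pos_right n hd) (Nat.le_mul_of_pos_left d hn1)

theorem theorem4p5 :
    ∃ (prog : RealRAM.Prog) (P : Polynomial ℕ) (A : ℝ),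
      ∀ (d n k : ℕ) (ε : ℝ) (x : Fin n → EuclideanSpace ℝ (Fin d)),
        2 ≤ n → 1 ≤ k → 0 < ε → ε < 1 → Function.Injective x →
        ∃ D : Multiset (EuclideanSpace ℝ (Fin d)),
          OrderedMedian.IsSimultaneousCoreset k ε (Finset.univ.val.map x) D ∧
          (OrderedMedian.size D : ℝ) ≤ A ^ d * ((k : ℝ) ^ 2 * Real.log n ^ 2 / ε ^ d) ∧
          ∃ (t : ℕ) (s : RealRAM.State),
            RealRAM.Exec prog (RealRAM.inputState k ε x) t s ∧
            t ≤ P.eval (n * d) ∧ RealRAM.Represents s D := by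
  obtain ⟨prog, P, h⟩ := theorem4p5_general
  refine ⟨prog, P, 2 * 36, fun d n k ε x hn hk hε hε1 hx => ?_⟩
  have hd := one_le_dim_of_injective hn hx
  obtain ⟨D, hD, hsize, hrun⟩ := h d n k ε x hd hn hk hε hε1.le
  refine ⟨D, hD, hsize.trans (pow_mul_le_two_mul_pow_mul (by norm_num) (by positivity) hd ?_), hrun⟩
  rw [mul_div_assoc']
  exact div_le_div_of_nonneg_right (mul_log_le_two_mul_sq_mul_log_sq hk hn) (by positivity)
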